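/- Let $S\subset\mathbb R^d$ be compact, let $C_+(S)$ be the space of nonnegative continuous functions on $S$ with the uniform metric, and let $X=(X_t)_{t\in\mathbb Z}$ be a stationary $C_+(S)$-valued time series that is regularly varying with index $\alpha>0$: for every nonempty finite $T\subset\mathbb Z$ there are a nondecreasing sequence $a_n\to\infty$ and a non-zero measure $\mu_T$ on $C_+(S)^T\setminus\{0\}$, finite on measurable sets bounded away from $0$ and homogeneous of order $-\alpha$, such that $n\,P((a_n^{-1}X_t)_{t\in T}\in A)\to\mu_T(A)$ for every measurable $A$ bounded away from $0$ with $\mu_T(\partial A)=0$. Let $\Theta=(\Theta_t)_{t\in\mathbb Z}$ be its spectral tail process, that is, $\|\Theta_0\|_\infty=1$ a.s. and, for every finite $T\subset\mathbb Z$, the conditional law of $(X_t/\|X_0\|_\infty)_{t\in T}$ given $\|X_0\|_\infty>x$ converges weakly to the law of $(\Theta_t)_{t\in T}$ as $x\to\infty$. Let $r:C_+(S)\to[0,\infty)$ be continuous with $r(cf)=c\,r(f)$ for all $c\ge0$ and $f\in C_+(S)$, and assume $E[r(\Theta_0)^\alpha]>0$. Let $\Theta^r=(\Theta^r_t)_{t\in\mathbb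 Z}$ be a process whose law is that of $(\Theta_t/r(\Theta_0))_{t\in\mathbb Z}$ under the probability measure with density $r(\Theta_0)^\alpha/E[r(\Theta_0)^\alpha]$, and assume $E[(1-r(\Theta^r_{-1})^\alpha)_+]>0$. For $\ell\ge1$ define $$P(C^r_u=\ell)=\frac{P(r(X_{-1})\le u,\ r(X_0)>u,\dots,r(X_{\ell-1})>u,\ r(X_\ell)\le u)}{P(r(X_{-1})\le u,\ r(X_0)>u)} .$$ Then the denominator is positive for all large $u$, and for every $\ell\ge1$ $$\lim_{u\to\infty}P(C^r_u=\ell)=p_\ell:=\frac{E\big[\big(\min\{1,r(\Theta^r_1)^\alpha,\dots,r(\Theta^r_{\ell-1})^\alpha\}-\max\{r(\Theta^r_{-1})^\alpha,r(\Theta^r_\ell)^\alpha\}\big)_+\big]}{E\big[\big(1-r(\Theta^r_{-1})^\alpha\big)_+\big]} .$$ Moreover, if $V$ is independent of $\Theta^r$ with $P(V>y)=y^{-\alpha}$ for $y\ge1$, then $$p_\ell=\frac{P(V r(\Theta^r_{-1})\le1,\ V r(\Theta^r_0)>1,\dots,V r(\Theta^r_{\ell-1})>1,\ V r(\Theta^r_\ell)\le1)}{P(V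 r(\Theta^r_{-1})\le1,\ V r(\Theta^r_0)>1)},$$ and $\sum_{\ell\ge1}p_\ell=1$, so that $(p_\ell)$ is a probability distribution. Further, let $w^*\in\mathbb R\cup\{\infty\}$ and let $\phi:(-\infty,w^*)\to[0,\infty)$ be nondecreasing and bijective over $(0,\infty)$, i.e. each $u>0$ has exactly one preimage $\phi^{-1}(u)$. Let $W=(W_t)_{t\in\mathbb Z}$ be a stationary $C(S)$-valued time series such that almost surely $W_t(s)<w^*$ and $X_t(s)=\phi(W_t(s))$ for all $s,t$, and let $r$ be also given on continuous functions $f:S\to(-\infty,w^*)$, with values in $(-\infty,w^*)$ and $\phi(r(f))=r(\phi\circ f)$. Then $\phi^{-1}(u)\to w^*$ as $u\to\infty$, and for every $\ell\ge1$ $$\frac{P(r(W_{-1})\le \phi^{-1}(u),\ r(W_0)>\phi^{-1}(u),\dots,r(W_{\ell-1})>\phi^{-1}(u),\ r(W_\ell)\le \phi^{-1}(u))}{P(r(W_{-1})\le \phi^{-1}(u),\ r(W_0)>\phi^{-1}(u))}$$ equals $P(C^r_u=\ell)$ for every $u>0$, and hence converges to $p_\ell$ as $u\to\infty$. -/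

import Mathlib

open MeasureTheory ProbabilityTheory Filter Topology
open scoped NNReal ENNReal Pointwise

noncomputable section

namespace ClusterExtremes

/-- The space of nonnegative continuous functions on a compact space, with the uniform metric. -/
abbrev CPlus (K : Type*) [TopologicalSpace K] : Type _ := C(K, ℝ≥0)

/-- The supremum norm of a nonnegative continuous function, i.e. its uniform distance to `0`. -/
def supNorm {K : Type*} [TopologicalSpace K] [CompactSpace K] (f : CPlus K) : ℝ := dist f 0

/-- A (strictly) stationary time series of random elements of `E`. -/
structure IsStationary {Ω E : Type*} [MeasurableSpace Ω] [MeasurableSpace E]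
    (P : Measure Ω) (X : ℤ → Ω → E) : Prop where
  measurable : ∀ t, Measurable (X t)
  map_shift : ∀ h : ℤ, P.map (fun ω t => X (t + h) ω) = P.map (fun ω t => X t ω)

section RegularVariation

variable {K : Type*} [TopologicalSpace K] [CompactSpace K] [MeasurableSpace (CPlus K)]

/-- A set of vectors of functions is bounded away from the origin. -/
def BoundedAway {T : Finset ℤ} (A : Set (T → CPlus K)) : Prop :=
  ∃ ε : ℝ, 0 < ε ∧ ∀ x ∈ A, ε ≤ dist x 0

/-- `μ` is the exponent measure of `(X_t)_{t ∈ T}` for the normalizing sequence `a`, homogeneous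
of order `-α`. A measure on the space without the origin is a measure on the whole space that
does not charge the origin. -/
structure IsExponentMeasure {Ω : Type*} [MeasurableSpace Ω] (P : Measure Ω)
    (X : ℤ → Ω → CPlus K) (α : ℝ) (T : Finset ℤ) (a : ℕ → ℝ≥0)
    (μ : Measure (T → CPlus K)) : Prop where
  monotone : Monotone a
  tendsto_atTop : Tendsto a atTop atTop
  ne_zero : μ ≠ 0
  origin : μ {0} = 0
  finite : ∀ A, MeasurableSet A → BoundedAway A → μ A < ∞
  tendsto : ∀ A, MeasurableSet A → BoundedAway A → μ (frontier A) = 0 →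
    Tendsto (fun n : ℕ => (n : ℝ≥0∞) * P {ω | (fun t : T => (a n)⁻¹ • X t ω) ∈ A}) atTop
      (𝓝 (μ A))
  homogeneous : ∀ c : ℝ≥0, 0 < c → ∀ A, MeasurableSet A →
    μ (c • A) = ENNReal.ofReal ((c : ℝ) ^ (-α)) * μ A

/-- A stationary time series with values in `C₊(K)` is regularly varying with index `α`. -/
structure IsRegularlyVarying {Ω : Type*} [MeasurableSpace Ω] (P : Measure Ω)
    (X : ℤ → Ω → CPlus K) (α : ℝ) : Prop where
  stationary : IsStationary P X
  exists_exponentMeasure : ∀ T : Finset ℤ, T.Nonempty → ∃ a μ, IsExponentMeasure P X α T a μ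

/-- `Θ` is a spectral tail process of `X`: `‖Θ₀‖ = 1` almost surely, and for each finite `T` the
conditional law of `(‖X₀‖⁻¹ X_t)_{t ∈ T}` given `‖X₀‖ > x` converges weakly to the law of
`(Θ_t)_{t ∈ T}` as `x → ∞`. -/
structure IsSpectralTailProcess {Ω Ω' : Type*} [MeasurableSpace Ω] [MeasurableSpace Ω']
    (P : Measure Ω) (X : ℤ → Ω → CPlus K) (P' : Measure Ω') (Θ : ℤ → Ω' → CPlus K) : Prop where
  measurable : ∀ t, Measurable (Θ t)
  norm_zero : ∀ᵐ ω ∂P', supNorm (Θ 0 ω) = 1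
  tendsto : ∀ (T : Finset ℤ) (g : BoundedContinuousFunction (T → CPlus K) ℝ),
    Tendsto
      (fun x : ℝ => ∫ ω, g (fun t : T => (supNorm (X 0 ω)).toNNReal⁻¹ • X t ω)
        ∂(P[|{ω | x < supNorm (X 0 ω)}])) atTop
      (𝓝 (∫ ω, g (fun t : T => Θ t ω) ∂P'))

/-- A risk functional: continuous and positively `1`-homogeneous. -/
structure IsRiskFunctional (r : CPlus K → ℝ≥0) : Prop where
  continuous : Continuous r
  homogeneous : ∀ (c : ℝ≥0) (f : CPlus K), r (c • f) = c * r f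

/-- The law of the process `Θ^r`, where `Q` is the law of `Θ`: the law of `(Θ_t / r(Θ₀))_t` under
the probability measure with density `r(Θ₀)^α / E[r(Θ₀)^α]`. By homogeneity of `r`, the sequence
`r(Θ^r_t)` is `r(Θ_t) / r(Θ₀)` under that measure. -/
def riskSpectralLaw (r : CPlus K → ℝ≥0) (α : ℝ) (Q : Measure (ℤ → CPlus K)) :
    Measure (ℤ → CPlus K) :=
  ((∫⁻ θ, ((r (θ 0) ^ α : ℝ≥0) : ℝ≥0∞) ∂Q)⁻¹ •
    Q.withDensity (fun θ => ((r (θ 0) ^ α : ℝ≥0) : ℝ≥0∞))).map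
      (fun θ t => (r (θ 0))⁻¹ • θ t)

/-- `E[min{1, r(Θ^r_1)^α, …, r(Θ^r_{ℓ-1})^α} - max{r(Θ^r_{-1})^α, r(Θ^r_ℓ)^α}]₊`, where `Q` is the
law of `Θ^r`. -/
def limitNumerator (r : CPlus K → ℝ≥0) (α : ℝ) (Q : Measure (ℤ → CPlus K)) (ℓ : ℕ) : ℝ :=
  ∫ θ, max ((Finset.Ico 1 ℓ).fold min 1 (fun i : ℕ => (r (θ i) : ℝ) ^ α)
    - max ((r (θ (-1)) : ℝ) ^ α) ((r (θ ℓ) : ℝ) ^ α)) 0 ∂Q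

/-- `E[1 - r(Θ^r_{-1})^α]₊`, where `Q` is the law of `Θ^r`. -/
def limitDenominator (r : CPlus K → ℝ≥0) (α : ℝ) (Q : Measure (ℤ → CPlus K)) : ℝ :=
  ∫ θ, max (1 - (r (θ (-1)) : ℝ) ^ α) 0 ∂Q

end RegularVariation

/-- A `u`-exceedance cluster of the real sequence `R` starts at time `t`. -/
def ClusterStarts (R : ℤ → ℝ) (u : ℝ) (t : ℤ) : Prop := R (t - 1) ≤ u ∧ u < R t

/-- The stretch `t, …, t + ℓ - 1` is a `u`-exceedance cluster (of size `ℓ`) of `R`. -/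
def IsCluster (R : ℤ → ℝ) (u : ℝ) (t : ℤ) (ℓ : ℕ) : Prop :=
  R (t - 1) ≤ u ∧ (∀ i : ℕ, i < ℓ → u < R (t + i)) ∧ R (t + ℓ) ≤ u

/-- The probability that a `u`-exceedance cluster of the random sequence `R` has size `ℓ`: the
probability that a cluster of size `ℓ` starts at time `0`, divided by the probability that a
cluster starts at time `0`. -/
def clusterSizeProb {Ω : Type*} [MeasurableSpace Ω] (P : Measure Ω) (R : ℤ → Ω → ℝ)
    (u : ℝ) (ℓ : ℕ) : ℝ :=
  P.real {ω | IsCluster (fun t => R t ω) u 0 ℓ} / P.real {ω | ClusterStarts (fun t => R t ω) u 0}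

/-- The half-line `(-∞, w*)`, with `w*` real or `∞`. -/
def below (wstar : EReal) : Set ℝ := {w | (w : EReal) < wstar}

/-- A nondecreasing marginal transformation `φ : (-∞, w*) → [0, ∞)`, bijective over `(0, ∞)`.
(No nondecreasing map is a bijection from `(-∞, w*)` onto `[0, ∞)` including the value `0`; both
increasing bijections onto `(0, ∞)` and maps such as the positive part are covered.) -/
structure IsMarginalTransform (φ : ℝ → ℝ) (wstar : EReal) : Prop where
  monotoneOn : MonotoneOn φ (below wstar)
  nonneg : ∀ w ∈ below wstar, 0 ≤ φ w
  bijOn : Set.BijOn φ (below wstar ∩ {w | 0 < φ w}) (Set.Ioi 0)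

/-- The inverse `φ⁻¹(u)`, for `u > 0`. -/
def transformInv (φ : ℝ → ℝ) (wstar : EReal) (u : ℝ) : ℝ :=
  Function.invFunOn φ (below wstar) u

/-- The functional `rho` on continuous functions with values in `(-∞, w*)` and the risk functional
`r` on nonnegative functions satisfy `φ(rho(f)) = r(φ ∘ f)`. In the applications `rho` and `r` are
given by one formula (a minimum, a maximum, a quantile). -/
def CommutesWith {K : Type*} [TopologicalSpace K] (r : CPlus K → ℝ≥0) (rho : C(K, ℝ) → ℝ)
    (φ : ℝ → ℝ) (wstar : EReal) : Prop :=
  ∀ f : C(K, ℝ), (∀ s, f s ∈ below wstar) →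
    rho f ∈ below wstar ∧
      ∀ g : CPlus K, (∀ s, (g s : ℝ) = φ (f s)) → φ (rho f) = (r g : ℝ)

end ClusterExtremes

end

/-!
Conditionally on `‖X₀‖ > u`, the pair `(‖X₀‖ / u, X / ‖X₀‖)` converges weakly to `(V, Θ)`, where the
Pareto variable `V` is independent of the spectral tail process `Θ`. With `m` the smallest risk
inside a cluster and `M` the largest risk at its two boundary times, cluster events have the form
`{m > u ≥ M}` for continuous `1`-homogeneous `m` and `M`, so that they are continuity sets of the
limit and `P(V m(Θ) > 1 ≥ V M(Θ)) = E[(m(Θ)^α - M(Θ)^α)₊]`; the density of the law of `Θ^r` absorbs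
the normalization by `r(Θ₀)`. No mass is lost in the limit: by stationarity, the `n + 1` disjoint
events that a cluster longer than `n` starts at one of the times `-n, …, 0` have equal probability,
and each of them forces an exceedance at time `0`, so that clusters longer than `n` have
probability `O(1/n)` uniformly in `u`.
-/

noncomputable section

namespace ClusterExtremes

/-! ### Weak convergence to a product law -/

lemma tendsto_measureReal_prod_Ioc {ι F : Type*} [MeasurableSpace F] {l : Filter ι}
    {μ : ι → Measure (ℝ × F)} [∀ i, IsFiniteMeasure (μ i)] {ν₁ : Measure ℝ} {ν₂ : Measure F}
    [IsFiniteMeasure ν₁] [IsFiniteMeasure ν₂] {B : Set F} (hB : MeasurableSet B)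
    (h : ∀ s : ℝ, Tendsto (fun i => (μ i).real (Set.Ioi s ×ˢ B)) l
      (𝓝 (ν₁.real (Set.Ioi s) * ν₂.real B)))
    (a b : ℝ) :
    Tendsto (fun i => (μ i).real (Set.Ioc a b ×ˢ B)) l
      (𝓝 ((ν₁.prod ν₂).real (Set.Ioc a b ×ˢ B))) := by
  have hdiff : Set.Ioc a b ×ˢ B = (Set.Ioi a ×ˢ B) \ (Set.Ioi (max a b) ×ˢ B) := by
    ext p
    simp only [Set.mem_prod, Set.mem_Ioc, Set.mem_sdiff, Set.mem_Ioi, max_lt_iff, not_and]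
    grind
  have hsub : Set.Ioi (max a b) ×ˢ B ⊆ Set.Ioi a ×ˢ B :=
    Set.prod_mono_left (Set.Ioi_subset_Ioi (le_max_left a b))
  have hmeas : MeasurableSet (Set.Ioi (max a b) ×ˢ B) := measurableSet_Ioi.prod hB
  rw [hdiff, measureReal_sdiff hsub hmeas, measureReal_prod_prod, measureReal_prod_prod]
  exact ((h a).sub (h (max a b))).congr fun i => (measureReal_sdiff hsub hmeas).symm

lemma isPiSystem_Ioc_prod_null_frontier {F : Type*} [TopologicalSpace F] [MeasurableSpace F]
    (ν : Measure F) :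
    IsPiSystem {s : Set (ℝ × F) | ∃ a b : ℝ, ∃ B : Set F,
      MeasurableSet B ∧ ν (frontier B) = 0 ∧ s = Set.Ioc a b ×ˢ B} := by
  rintro _ ⟨a, b, B, hB, hνB, rfl⟩ _ ⟨a', b', B', hB', hνB', rfl⟩ -
  exact ⟨a ⊔ a', b ⊓ b', B ∩ B', hB.inter hB',
    null_frontier_inter hνB hνB', by rw [Set.prod_inter_prod, Set.Ioc_inter_Ioc]⟩

lemma tendsto_prod_of_tendsto_Ioi_prod {ι F : Type*} [TopologicalSpace F]
    [TopologicalSpace.PseudoMetrizableSpace F] [SecondCountableTopology F] [MeasurableSpace F]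
    [OpensMeasurableSpace F] {l : Filter ι} [l.IsCountablyGenerated]
    {μ : ι → ProbabilityMeasure (ℝ × F)} {ν₁ : ProbabilityMeasure ℝ} {ν₂ : ProbabilityMeasure F}
    (h : ∀ (s : ℝ) (B : Set F), MeasurableSet B → (ν₂ : Measure F) (frontier B) = 0 →
      Tendsto (fun i => (μ i : Measure (ℝ × F)).real (Set.Ioi s ×ˢ B)) l
        (𝓝 ((ν₁ : Measure ℝ).real (Set.Ioi s) * (ν₂ : Measure F).real B))) :
    Tendsto μ l (𝓝 (ν₁.prod ν₂)) := by
  let : PseudoMetricSpace F := TopologicalSpace.pseudoMetrizableSpacePseudoMetric F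
  refine (isPiSystem_Ioc_prod_null_frontier (ν₂ : Measure F)
    ).tendsto_probabilityMeasure_of_tendsto_of_mem ?_ ?_ ?_
  · rintro _ ⟨a, b, B, hB, -, rfl⟩
    exact measurableSet_Ioc.prod hB
  · rintro U hU ⟨x, y⟩ hxy
    obtain ⟨ε, hε, hεU⟩ := Metric.isOpen_iff.1 hU _ hxy
    obtain ⟨δ, ⟨hδ, hδε⟩, hδν⟩ := exists_null_frontier_thickening (ν₂ : Measure F) {y} hε
    rw [Metric.thickening_singleton] at hδν
    refine ⟨_, ⟨x - δ, x + δ / 2, _, Metric.isOpen_ball.measurableSet, hδν, rfl⟩,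
      prod_mem_nhds (Ioc_mem_nhds (by linarith) (by linarith)) (Metric.ball_mem_nhds y hδ),
      fun p hp => hεU ?_⟩
    rw [← ball_prod_same]
    refine ⟨?_, Metric.ball_subset_ball hδε.le hp.2⟩
    rw [Real.ball_eq_Ioo]
    exact ⟨by linarith [hp.1.1], by linarith [hp.1.2]⟩
  · rintro _ ⟨a, b, B, hB, hνB, rfl⟩
    rw [← NNReal.tendsto_coe]
    exact tendsto_measureReal_prod_Ioc hB (fun s => h s B hB hνB) a b

/-! ### Weak convergence of finite-dimensional distributions -/

section FiniteDimensional

variable {ι : Type*} {E : ι → Type*} [∀ i, TopologicalSpace (E i)]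
  [∀ i, SecondCountableTopology (E i)] [∀ i, MeasurableSpace (E i)]
  [∀ i, OpensMeasurableSpace (E i)]

lemma map_restrict_frontier_preimage_restrict₂ (ν : Measure (∀ i, E i)) {S T : Finset ι}
    (hST : S ⊆ T) {B : Set (∀ i : S, E i)} (hB : ν.map S.restrict (frontier B) = 0) :
    ν.map T.restrict (frontier (Finset.restrict₂ (π := E) hST ⁻¹' B)) = 0 := by
  refine measure_mono_null ((Finset.continuous_restrict₂ hST).frontier_preimage_subset B) ?_
  have hmeas : MeasurableSet (frontier B) := isClosed_frontier.measurableSet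
  rwa [Measure.map_apply (Finset.measurable_restrict T) (Finset.measurable_restrict₂ hST hmeas),
    ← Set.preimage_comp, Finset.restrict₂_comp_restrict,
    ← Measure.map_apply (Finset.measurable_restrict S) hmeas]

lemma isPiSystem_cylinder_null_frontier (ν : Measure (∀ i, E i)) :
    IsPiSystem {s : Set (∀ i, E i) | ∃ (T : Finset ι) (B : Set (∀ i : T, E i)),
      MeasurableSet B ∧ ν.map T.restrict (frontier B) = 0 ∧ s = cylinder T B} := by
  classical
  rintro _ ⟨T, B, hB, hνB, rfl⟩ _ ⟨T', B', hB', hνB', rfl⟩ -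
  refine ⟨T ∪ T', _, ?_, ?_, inter_cylinder T T' B B'⟩
  · exact (Finset.measurable_restrict₂ _ hB).inter (Finset.measurable_restrict₂ _ hB')
  · exact null_frontier_inter (map_restrict_frontier_preimage_restrict₂ ν _ hνB)
      (map_restrict_frontier_preimage_restrict₂ ν _ hνB')

lemma exists_cylinder_null_frontier_mem_nhds [∀ i, TopologicalSpace.PseudoMetrizableSpace (E i)]
    (ν : Measure (∀ i, E i)) [IsFiniteMeasure ν] {x : ∀ i, E i} {U : Set (∀ i, E i)}
    (hU : U ∈ 𝓝 x) :
    ∃ (T : Finset ι) (B : Set (∀ i : T, E i)), MeasurableSet B ∧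
      ν.map T.restrict (frontier B) = 0 ∧ cylinder T B ∈ 𝓝 x ∧ cylinder T B ⊆ U := by
  let : ∀ i, PseudoMetricSpace (E i) := fun i =>
    TopologicalSpace.pseudoMetrizableSpacePseudoMetric (E i)
  rw [nhds_pi, Filter.mem_pi'] at hU
  obtain ⟨T, V, hV, hVU⟩ := hU
  obtain ⟨ε, hε, hεV⟩ := Metric.mem_nhds_iff.1
    (set_pi_mem_nhds (x := T.restrict x) Set.finite_univ fun i _ => hV i)
  obtain ⟨δ, ⟨hδ, hδε⟩, hδν⟩ :=
    exists_null_frontier_thickening (ν.map T.restrict) {T.restrict x} hε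
  rw [Metric.thickening_singleton] at hδν
  refine ⟨T, Metric.ball (T.restrict x) δ, Metric.isOpen_ball.measurableSet, hδν,
    (Finset.continuous_restrict T).continuousAt.preimage_mem_nhds (Metric.ball_mem_nhds _ hδ),
    fun y hy => hVU fun i hi => ?_⟩
  exact hεV (Metric.ball_subset_ball hδε.le hy) ⟨i, hi⟩ (Set.mem_univ _)

lemma tendsto_of_forall_tendsto_map_restrict [Countable ι]
    [∀ i, TopologicalSpace.PseudoMetrizableSpace (E i)] {κ : Type*} {l : Filter κ}
    [l.IsCountablyGenerated] {μ : κ → ProbabilityMeasure (∀ i, E i)}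
    {ν : ProbabilityMeasure (∀ i, E i)}
    (h : ∀ T : Finset ι, Tendsto
      (fun k => (μ k).map (Finset.measurable_restrict T).aemeasurable) l
      (𝓝 (ν.map (Finset.measurable_restrict T).aemeasurable))) :
    Tendsto μ l (𝓝 ν) := by
  refine (isPiSystem_cylinder_null_frontier (ν : Measure (∀ i, E i))
    ).tendsto_probabilityMeasure_of_tendsto_of_mem ?_ ?_ ?_
  · rintro _ ⟨T, B, hB, -, rfl⟩
    exact hB.cylinder T
  · intro U hU x hx
    obtain ⟨T, B, hB, hνB, hmem, hsub⟩ :=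
      exists_cylinder_null_frontier_mem_nhds (ν : Measure (∀ i, E i)) (hU.mem_nhds hx)
    exact ⟨_, ⟨T, B, hB, hνB, rfl⟩, hmem, hsub⟩
  · rintro _ ⟨T, B, hB, hνB, rfl⟩
    have hlim := ProbabilityMeasure.tendsto_measure_of_null_frontier_of_tendsto (h T)
      ((ProbabilityMeasure.null_iff_toMeasure_null _ _).2 hνB)
    simpa only [ProbabilityMeasure.map_apply _ (Finset.measurable_restrict T).aemeasurable hB,
      cylinder] using hlim

lemma integral_map_restrict {Ω : Type*} [MeasurableSpace Ω] {μ : Measure Ω}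
    {Y : Ω → ∀ i, E i} (hY : Measurable Y) (T : Finset ι) {g : (∀ i : T, E i) → ℝ}
    (hg : Continuous g) :
    ∫ z, g z ∂((μ.map Y).map T.restrict) = ∫ ω, g (fun i : T => Y ω i) ∂μ := by
  rw [Measure.map_map (Finset.measurable_restrict T) hY,
    integral_map ((Finset.measurable_restrict T).comp hY).aemeasurable hg.aestronglyMeasurable]
  rfl

end FiniteDimensional

/-! ### The Pareto law -/

lemma rpow_sub_min_rpow {α : ℝ} {m M : ℝ≥0} (hα : 0 ≤ α) :
    (m : ℝ) ^ α - ((min m M : ℝ≥0) : ℝ) ^ α = max ((m : ℝ) ^ α - (M : ℝ) ^ α) 0 := by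
  rcases le_total m M with h | h
  · rw [min_eq_left h, sub_self, max_eq_right]
    exact sub_nonpos.2 (Real.rpow_le_rpow m.2 h hα)
  · rw [min_eq_right h, max_eq_left]
    exact sub_nonneg.2 (Real.rpow_le_rpow M.2 h hα)

lemma max_mul_rpow_sub_mul_rpow {α : ℝ} (c m M : ℝ≥0) :
    max (((c * m : ℝ≥0) : ℝ) ^ α - ((c * M : ℝ≥0) : ℝ) ^ α) 0
      = (c : ℝ) ^ α * max ((m : ℝ) ^ α - (M : ℝ) ^ α) 0 := by
  rw [NNReal.coe_mul, NNReal.coe_mul, Real.mul_rpow c.coe_nonneg m.coe_nonneg,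
    Real.mul_rpow c.coe_nonneg M.coe_nonneg, mul_max_of_nonneg _ _ (by positivity), mul_zero,
    mul_sub]

lemma nullSingletonClass_paretoMeasure (t α : ℝ) : NullSingletonClass (paretoMeasure t α) := by
  unfold paretoMeasure
  infer_instance

/-- The law of the Pareto variable `V` with `P(V > y) = y ^ (-α)` for `y ≥ 1`, as a probability
measure. -/
def standardPareto {α : ℝ} (hα : 0 < α) : ProbabilityMeasure ℝ :=
  ⟨paretoMeasure 1 α, isProbabilityMeasure_paretoMeasure one_pos hα⟩

lemma coe_standardPareto {α : ℝ} (hα : 0 < α) :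
    (standardPareto hα : Measure ℝ) = paretoMeasure 1 α := rfl

lemma paretoMeasure_real_Ioi_of_le {t α a : ℝ} (ht : 0 < t) (hα : 0 < α) (ha : t ≤ a) :
    (paretoMeasure t α).real (Set.Ioi a) = (t / a) ^ α := by
  have ha0 : 0 < a := ht.trans_le ha
  have hpdf : ∀ x ∈ Set.Ioi a, paretoPDF t α x = ENNReal.ofReal (α * t ^ α * x ^ (-(α + 1))) :=
    fun x hx => paretoPDF_of_le (ha.trans (le_of_lt hx))
  rw [measureReal_def, paretoMeasure, withDensity_apply _ measurableSet_Ioi,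
    setLIntegral_congr_fun measurableSet_Ioi hpdf, ← integral_eq_lintegral_of_nonneg_ae]
  · rw [integral_const_mul, integral_Ioi_rpow_of_lt (by linarith) ha0,
      show -(α + 1) + 1 = -α by ring, Real.rpow_neg ha0.le, Real.div_rpow ht.le ha0.le]
    field_simp
  · filter_upwards [ae_restrict_mem measurableSet_Ioi] with x hx
    have : 0 < x := ha0.trans hx
    positivity
  · exact (measurable_const.mul (measurable_id.pow_const _)).aestronglyMeasurable

lemma paretoMeasure_real_Ioi {t α : ℝ} (ht : 0 < t) (hα : 0 < α) (s : ℝ) :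
    (paretoMeasure t α).real (Set.Ioi s) = (t / max t s) ^ α := by
  have := isProbabilityMeasure_paretoMeasure ht hα
  rcases le_total t s with h | h
  · rw [max_eq_right h, paretoMeasure_real_Ioi_of_le ht hα h]
  · rw [max_eq_left h, div_self ht.ne', Real.one_rpow]
    refine le_antisymm measureReal_le_one ?_
    calc (1 : ℝ) = (paretoMeasure t α).real (Set.Ioi t) := by
          rw [paretoMeasure_real_Ioi_of_le ht hα le_rfl, div_self ht.ne', Real.one_rpow]
      _ ≤ (paretoMeasure t α).real (Set.Ioi s) := measureReal_mono (Set.Ioi_subset_Ioi h)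

lemma paretoMeasure_real_one_lt_mul {α : ℝ} (hα : 0 < α) {x : ℝ≥0} (hx : x ≤ 1) :
    (paretoMeasure 1 α).real {v | 1 < v * (x : ℝ)} = (x : ℝ) ^ α := by
  rcases eq_or_ne x 0 with rfl | h0
  · simp [Real.zero_rpow hα.ne', not_lt.2 (zero_le_one' ℝ)]
  have hx0 : (0 : ℝ) < x := by positivity
  have hset : {v : ℝ | 1 < v * (x : ℝ)} = Set.Ioi (x : ℝ)⁻¹ := by
    ext v
    simp only [Set.mem_ofPred_eq, Set.mem_Ioi, inv_lt_iff_one_lt_mul₀ hx0]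
  rw [hset, paretoMeasure_real_Ioi_of_le one_pos hα ((one_le_inv₀ hx0).2 (by exact_mod_cast hx)),
    one_div, inv_inv]

lemma one_lt_mul_and_mul_le_one_iff {v : ℝ} {m M : ℝ≥0} :
    1 < v * m ∧ v * M ≤ 1 ↔ 1 < v * m ∧ ¬1 < v * (min m M : ℝ≥0) := by
  refine and_congr_right fun hm => ?_
  have hv : 0 ≤ v := by
    by_contra! hv
    exact absurd hm (not_lt.2 ((mul_nonpos_of_nonpos_of_nonneg hv.le m.2).trans zero_le_one))
  rw [NNReal.coe_min, mul_min_of_nonneg _ _ hv, lt_min_iff, not_and, not_lt, forall_prop_of_true hm]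

lemma paretoMeasure_real_one_lt_mul_and {α : ℝ} (hα : 0 < α) {m M : ℝ≥0} (hm : m ≤ 1) :
    (paretoMeasure 1 α).real {v | 1 < v * (m : ℝ) ∧ v * (M : ℝ) ≤ 1}
      = max ((m : ℝ) ^ α - (M : ℝ) ^ α) 0 := by
  have := isProbabilityMeasure_paretoMeasure one_pos hα
  have hmeas : ∀ x : ℝ≥0, MeasurableSet {v : ℝ | 1 < v * (x : ℝ)} := fun x =>
    measurableSet_lt measurable_const (by fun_prop)
  have hsub : {v : ℝ | 1 < v * ((min m M : ℝ≥0) : ℝ)} ⊆ {v | 1 < v * (m : ℝ)} := by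
    intro v (hv : 1 < v * ((min m M : ℝ≥0) : ℝ))
    have hv0 : 0 < v := pos_of_mul_pos_left (one_pos.trans hv) (min m M).2
    exact hv.trans_le (by gcongr; exact min_le_left m M)
  rw [← rpow_sub_min_rpow hα.le, ← paretoMeasure_real_one_lt_mul hα hm,
    ← paretoMeasure_real_one_lt_mul hα ((min_le_left m M).trans hm),
    ← measureReal_sdiff hsub (hmeas _)]
  congr 1
  ext v
  exact one_lt_mul_and_mul_le_one_iff

lemma paretoMeasure_prod_real_one_lt_mul_and {E : Type*} [MeasurableSpace E] {Q : Measure E}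
    [IsProbabilityMeasure Q] {α : ℝ} (hα : 0 < α) {m M : E → ℝ≥0} (hm : Measurable m)
    (hM : Measurable M) (hle : ∀ᵐ θ ∂Q, m θ ≤ 1) :
    ((paretoMeasure 1 α).prod Q).real {p | 1 < p.1 * (m p.2 : ℝ) ∧ p.1 * (M p.2 : ℝ) ≤ 1}
      = ∫ θ, max ((m θ : ℝ) ^ α - (M θ : ℝ) ^ α) 0 ∂Q := by
  have := isProbabilityMeasure_paretoMeasure one_pos hα
  have hmeas : MeasurableSet {p : ℝ × E | 1 < p.1 * (m p.2 : ℝ) ∧ p.1 * (M p.2 : ℝ) ≤ 1} := by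
    measurability
  rw [measureReal_def, Measure.prod_apply_symm hmeas, ← integral_toReal]
  · refine integral_congr_ae ?_
    filter_upwards [hle] with θ hθ
    rw [← paretoMeasure_real_one_lt_mul_and hα hθ, measureReal_def]
    rfl
  · exact (measurable_measure_prodMk_right hmeas).aemeasurable
  · exact Eventually.of_forall fun θ => measure_lt_top _ _

section FrontierNull

variable {F : Type*} [MeasurableSpace F] {μ : Measure ℝ} [NullSingletonClass μ] {Q : Measure F}
  [SFinite Q]

lemma prod_fst_mul_eq_one_null [SFinite μ] {m : F → ℝ} (hm : Measurable m) :
    (μ.prod Q) {p | p.1 * m p.2 = 1} = 0 := by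
  have hmeas : MeasurableSet {p : ℝ × F | p.1 * m p.2 = 1} :=
    measurableSet_eq_fun (by fun_prop) measurable_const
  rw [Measure.prod_apply_symm hmeas]
  refine lintegral_eq_zero_of_ae_eq_zero (Eventually.of_forall fun x => ?_)
  refine Set.Subsingleton.measure_zero (fun v hv w hw => ?_) μ
  have hx : m x ≠ 0 := right_ne_zero_of_mul_eq_one hv
  exact mul_right_cancel₀ hx (hv.trans hw.symm)

lemma measure_frontier_one_lt_mul_and_mul_le_one [SFinite μ] [TopologicalSpace F]
    [OpensMeasurableSpace F] {m M : F → ℝ≥0} (hm : Continuous m) (hM : Continuous M) :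
    (μ.prod Q) (frontier {p | 1 < p.1 * (m p.2 : ℝ) ∧ p.1 * (M p.2 : ℝ) ≤ 1}) = 0 := by
  have hm' : Continuous fun p : ℝ × F => p.1 * (m p.2 : ℝ) := by fun_prop
  have hM' : Continuous fun p : ℝ × F => p.1 * (M p.2 : ℝ) := by fun_prop
  rw [Set.ofPred_and]
  refine null_frontier_inter
    (measure_mono_null ((frontier_lt_subset_eq continuous_const hm').trans fun p hp => ?_)
      (prod_fst_mul_eq_one_null (m := fun x => (m x : ℝ)) hm.measurable.coe_nnreal_real))
    (measure_mono_null (frontier_le_subset_eq hM' continuous_const)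
      (prod_fst_mul_eq_one_null (m := fun x => (M x : ℝ)) hM.measurable.coe_nnreal_real))
  exact Eq.symm hp

end FrontierNull

/-! ### Regularly varying tails -/

lemma exists_tendsto_nat_mem_Ico {a : ℕ → ℝ} (ha : Monotone a) (ha' : Tendsto a atTop atTop) :
    ∃ ν : ℝ → ℕ, Tendsto ν atTop atTop ∧ ∀ᶠ u in atTop, u ∈ Set.Ico (a (ν u)) (a (ν u + 1)) := by
  have hex : ∀ u, ∃ n, a 0 ≤ u → u ∈ Set.Ico (a n) (a (n + 1)) := by
    intro u
    by_contra! h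
    have hle : ∀ n, a n ≤ u := by
      intro n
      induction n with
      | zero => exact (h 0).1
      | succ n ih => exact not_lt.1 fun hlt => (h n).2 ⟨ih, hlt⟩
    obtain ⟨n, hn⟩ := (ha'.eventually_gt_atTop u).exists
    exact not_lt.2 (hle n) hn
  choose ν hν using hex
  refine ⟨ν, tendsto_atTop.2 fun k => ?_, (eventually_ge_atTop (a 0)).mono hν⟩
  filter_upwards [eventually_ge_atTop (a k), eventually_ge_atTop (a 0)] with u hk h0
  by_contra! hlt
  exact not_lt.2 (hk.trans' (ha hlt)) (hν u h0).2

lemma tendsto_nat_mul_shift {f : ℕ → ℝ} {x : ℝ}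
    (hf : Tendsto (fun n : ℕ => n * f n) atTop (𝓝 x)) :
    Tendsto (fun n : ℕ => n * f (n + 1)) atTop (𝓝 x) := by
  have h := (tendsto_natCast_div_add_atTop (1 : ℝ)).mul (hf.comp (tendsto_add_atTop_nat 1))
  rw [one_mul] at h
  refine h.congr fun n => ?_
  simp only [Function.comp_apply, Nat.cast_add, Nat.cast_one]
  field_simp

lemma tendsto_div_of_tendsto_nat_mul {f g : ℕ → ℝ} {x y : ℝ}
    (hf : Tendsto (fun n : ℕ => n * f n) atTop (𝓝 x))
    (hg : Tendsto (fun n : ℕ => n * g n) atTop (𝓝 y)) (hy : y ≠ 0) :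
    Tendsto (fun n => f n / g n) atTop (𝓝 (x / y)) := by
  refine (hf.div hg hy).congr' ?_
  filter_upwards [eventually_ne_atTop 0] with n hn
  exact mul_div_mul_left _ _ (Nat.cast_ne_zero.2 hn)

lemma pos_of_antitone_of_tendsto_nat_mul {G : ℝ → ℝ} (hG : Antitone G)
    {a : ℕ → ℝ} (ha : Tendsto a atTop atTop) {c : ℝ} (hc : 0 < c)
    (h : Tendsto (fun n : ℕ => n * G (a n)) atTop (𝓝 c)) (u : ℝ) : 0 < G u := by
  obtain ⟨n, hn, hun⟩ :=
    ((h.eventually (lt_mem_nhds hc)).and (ha.eventually_ge_atTop u)).exists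
  exact (pos_of_mul_pos_right hn n.cast_nonneg).trans_le (hG hun)

lemma tendsto_div_of_antitone_of_tendsto_nat_mul {G : ℝ → ℝ} (hG : Antitone G)
    {a : ℕ → ℝ} (ha : Monotone a) (ha' : Tendsto a atTop atTop) {c x y : ℝ} (hc : 0 < c)
    (hy : 0 ≤ y) (h1 : Tendsto (fun n : ℕ => n * G (a n)) atTop (𝓝 c))
    (h : Tendsto (fun n : ℕ => n * G (a n * y)) atTop (𝓝 x)) :
    Tendsto (fun u => G (u * y) / G u) atTop (𝓝 (x / c)) := by
  have hpos := pos_of_antitone_of_tendsto_nat_mul hG ha' hc h1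
  have hupper : Tendsto (fun n => G (a n * y) / G (a (n + 1))) atTop (𝓝 (x / c)) :=
    tendsto_div_of_tendsto_nat_mul h (tendsto_nat_mul_shift h1) hc.ne'
  have hlower : Tendsto (fun n => G (a (n + 1) * y) / G (a n)) atTop (𝓝 (x / c)) :=
    tendsto_div_of_tendsto_nat_mul (tendsto_nat_mul_shift h) h1 hc.ne'
  obtain ⟨ν, hν, hmem⟩ := exists_tendsto_nat_mem_Ico ha ha'
  refine tendsto_of_tendsto_of_tendsto_of_le_of_le' (hlower.comp hν) (hupper.comp hν) ?_ ?_
  · filter_upwards [hmem] with u hu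
    exact div_le_div₀ (hpos _).le (hG (mul_le_mul_of_nonneg_right hu.2.le hy)) (hpos _) (hG hu.1)
  · filter_upwards [hmem] with u hu
    exact div_le_div₀ (hpos _).le (hG (mul_le_mul_of_nonneg_right hu.1 hy)) (hpos _) (hG hu.2.le)

/-- The tail `u ↦ P(N > u)` is regularly varying at infinity with index `-α`. It is required to
be positive everywhere, so that the quotients are not junk values. -/
structure HasRegularlyVaryingTail {Ω : Type*} [MeasurableSpace Ω] (P : Measure Ω) (N : Ω → ℝ)
    (α : ℝ) : Prop where
  pos : ∀ u, 0 < P.real {ω | u < N ω}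
  tendsto : ∀ y, 0 < y →
    Tendsto (fun u => P.real {ω | u * y < N ω} / P.real {ω | u < N ω}) atTop (𝓝 (y ^ (-α)))

namespace HasRegularlyVaryingTail

variable {Ω : Type*} [MeasurableSpace Ω] {P : Measure Ω} {N : Ω → ℝ} {α : ℝ}

lemma of_tendsto_nat_mul [IsFiniteMeasure P] {a : ℕ → ℝ} (ha : Monotone a)
    (ha' : Tendsto a atTop atTop) {c : ℝ} (hc : 0 < c)
    (h : ∀ y, 0 < y → Tendsto (fun n : ℕ => n * P.real {ω | a n * y < N ω}) atTop
      (𝓝 (c * y ^ (-α)))) :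
    HasRegularlyVaryingTail P N α := by
  have hG : Antitone fun u => P.real {ω | u < N ω} := fun u v huv =>
    measureReal_mono fun ω (hω : v < N ω) => huv.trans_lt hω
  have h1 : Tendsto (fun n : ℕ => n * P.real {ω | a n < N ω}) atTop (𝓝 c) := by
    simpa only [mul_one, Real.one_rpow] using h 1 one_pos
  refine ⟨pos_of_antitone_of_tendsto_nat_mul hG ha' hc h1, fun y hy => ?_⟩
  have hlim := tendsto_div_of_antitone_of_tendsto_nat_mul hG ha ha' hc hy.le h1 (h y hy)
  rwa [mul_div_cancel_left₀ _ hc.ne'] at hlim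

lemma tendsto_const_mul (hN : HasRegularlyVaryingTail P N α) {C : ℝ} (hC : 0 < C) :
    Tendsto (fun u => P.real {ω | u < C * N ω} / P.real {ω | u < N ω}) atTop (𝓝 (C ^ α)) := by
  have h := hN.tendsto C⁻¹ (inv_pos.2 hC)
  rw [Real.inv_rpow hC.le, Real.rpow_neg hC.le, inv_inv] at h
  simpa only [← div_eq_mul_inv, div_lt_iff₀' hC] using h

lemma const_mul (hN : HasRegularlyVaryingTail P N α) {C : ℝ} (hC : 0 < C) :
    HasRegularlyVaryingTail P (fun ω => C * N ω) α := by
  have hset : ∀ u, {ω | u < C * N ω} = {ω | C⁻¹ * u < N ω} := fun u => by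
    simp only [inv_mul_lt_iff₀ hC]
  refine ⟨fun u => (hset u).symm ▸ hN.pos _, fun y hy => ?_⟩
  have hscale : Tendsto (fun u => C⁻¹ * u) atTop atTop :=
    tendsto_id.const_mul_atTop (inv_pos.2 hC)
  simpa only [Function.comp_def, hset, mul_assoc] using (hN.tendsto y hy).comp hscale

section ExceedanceLaw

variable {F : Type*} [MeasurableSpace F] [IsFiniteMeasure P]

/-- The law of `H` conditionally on `N` exceeding `u`, as a probability measure. -/
def exceedanceLaw (hN : HasRegularlyVaryingTail P N α) {H : Ω → F} (hH : Measurable H) (u : ℝ) :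
    ProbabilityMeasure F :=
  ⟨(P[|{ω | u < N ω}]).map H,
    have := cond_isProbabilityMeasure ((measureReal_ne_zero_iff (measure_ne_top _ _)).1
      (hN.pos u).ne')
    Measure.isProbabilityMeasure_map hH.aemeasurable⟩

lemma exceedanceLaw_real_apply (hN : HasRegularlyVaryingTail P N α) (hNm : Measurable N)
    {H : Ω → F} (hH : Measurable H) (u : ℝ) {s : Set F} (hs : MeasurableSet s) :
    (hN.exceedanceLaw hH u : Measure F).real s
      = P.real ({ω | u < N ω} ∩ H ⁻¹' s) / P.real {ω | u < N ω} := by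
  have hset : MeasurableSet {ω | u < N ω} := measurableSet_lt measurable_const hNm
  rw [exceedanceLaw, ProbabilityMeasure.coe_mk, map_measureReal_apply hH hs, measureReal_def,
    cond_apply hset, ENNReal.toReal_mul, ENNReal.toReal_inv, inv_mul_eq_div]
  rfl

lemma exceedanceLaw_const_mul (hN : HasRegularlyVaryingTail P N α) {C : ℝ} (hC : 0 < C)
    {H : Ω → F} (hH : Measurable H) (u : ℝ) :
    (hN.const_mul hC).exceedanceLaw hH u = hN.exceedanceLaw hH (C⁻¹ * u) := by
  simp only [exceedanceLaw, inv_mul_lt_iff₀ hC]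
  rfl

lemma tendsto_exceedanceLaw_prod [TopologicalSpace F] [TopologicalSpace.PseudoMetrizableSpace F]
    [SecondCountableTopology F] [OpensMeasurableSpace F] (hα : 0 < α)
    (hN : HasRegularlyVaryingTail P N α) (hNm : Measurable N) {H : Ω → F} (hH : Measurable H)
    {Λ : ProbabilityMeasure F} (hΛ : Tendsto (hN.exceedanceLaw hH) atTop (𝓝 Λ)) :
    Tendsto (fun u => hN.exceedanceLaw ((hNm.div_const u).prodMk hH) u) atTop
      (𝓝 ((standardPareto hα).prod Λ)) := by
  have hgt : ∀ u s : ℝ, 0 < u →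
      {ω | u < N ω} ∩ (fun ω => N ω / u) ⁻¹' Set.Ioi s = {ω | u * max 1 s < N ω} := by
    intro u s hu
    ext ω
    simp [lt_div_iff₀' hu, mul_max_of_nonneg _ _ hu.le]
  refine tendsto_prod_of_tendsto_Ioi_prod fun s B hB hνB => ?_
  have hs : 0 < max 1 s := one_pos.trans_le (le_max_left 1 s)
  have hscale : Tendsto (fun u : ℝ => u * max 1 s) atTop atTop := tendsto_id.atTop_mul_const hs
  have hlimB : Tendsto (fun u => (hN.exceedanceLaw hH u : Measure F).real B) atTop
      (𝓝 ((Λ : Measure F).real B)) := NNReal.tendsto_coe.2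
    (ProbabilityMeasure.tendsto_measure_of_null_frontier_of_tendsto hΛ
      ((ProbabilityMeasure.null_iff_toMeasure_null _ _).2 hνB))
  rw [coe_standardPareto, paretoMeasure_real_Ioi one_pos hα, one_div, Real.inv_rpow hs.le,
    ← Real.rpow_neg hs.le]
  refine ((hN.tendsto _ hs).mul (hlimB.comp hscale)).congr' ?_
  filter_upwards [eventually_gt_atTop 0] with u hu
  rw [Function.comp_apply, exceedanceLaw_real_apply hN hNm hH _ hB,
    exceedanceLaw_real_apply hN hNm _ _ (measurableSet_Ioi.prod hB), Set.mk_preimage_prod,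
    ← Set.inter_assoc, hgt u s hu]
  field_simp [(hN.pos u).ne', (hN.pos (u * max 1 s)).ne']

lemma tendsto_measureReal_lt_mul_and_mul_le_of_le_one [TopologicalSpace F]
    [TopologicalSpace.PseudoMetrizableSpace F] [SecondCountableTopology F]
    [OpensMeasurableSpace F] (hα : 0 < α) (hN : HasRegularlyVaryingTail P N α)
    (hNm : Measurable N) {H : Ω → F} (hH : Measurable H) {Λ : ProbabilityMeasure F}
    (hΛ : Tendsto (hN.exceedanceLaw hH) atTop (𝓝 Λ)) {m M : F → ℝ≥0} (hm : Continuous m)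
    (hM : Continuous M) (hmH : ∀ ω, N ω * m (H ω) ≤ N ω) (hmΛ : ∀ᵐ x ∂(Λ : Measure F), m x ≤ 1) :
    Tendsto (fun u => P.real {ω | u < N ω * m (H ω) ∧ N ω * M (H ω) ≤ u} / P.real {ω | u < N ω})
      atTop (𝓝 (∫ x, max ((m x : ℝ) ^ α - (M x : ℝ) ^ α) 0 ∂(Λ : Measure F))) := by
  set A : Set (ℝ × F) := {p | 1 < p.1 * (m p.2 : ℝ) ∧ p.1 * (M p.2 : ℝ) ≤ 1} with hA
  have hAm : MeasurableSet A := by measurability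
  have := nullSingletonClass_paretoMeasure 1 α
  have := isProbabilityMeasure_paretoMeasure one_pos hα
  have hfr : ((standardPareto hα).prod Λ : Measure (ℝ × F)) (frontier A) = 0 := by
    rw [ProbabilityMeasure.toMeasure_prod, coe_standardPareto]
    exact measure_frontier_one_lt_mul_and_mul_le_one hm hM
  have hlim := ProbabilityMeasure.tendsto_measure_of_null_frontier_of_tendsto
    (hN.tendsto_exceedanceLaw_prod hα hNm hH hΛ)
    ((ProbabilityMeasure.null_iff_toMeasure_null _ _).2 hfr)
  rw [← paretoMeasure_prod_real_one_lt_mul_and hα hm.measurable hM.measurable hmΛ]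
  refine (NNReal.tendsto_coe.2 hlim).congr' ?_
  filter_upwards [eventually_gt_atTop 0] with u hu
  refine (hN.exceedanceLaw_real_apply hNm _ u hAm).trans ?_
  congr 2
  ext ω
  simp only [hA, Set.mem_inter_iff, Set.mem_ofPred_eq, Set.mem_preimage, div_mul_eq_mul_div,
    one_lt_div hu, div_le_one hu, and_iff_right_iff_imp]
  exact fun h => h.1.trans_le (hmH ω)

lemma tendsto_measureReal_lt_mul_and_mul_le [TopologicalSpace F]
    [TopologicalSpace.PseudoMetrizableSpace F] [SecondCountableTopology F]
    [OpensMeasurableSpace F] (hα : 0 < α) (hN : HasRegularlyVaryingTail P N α)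
    (hNm : Measurable N) {H : Ω → F} (hH : Measurable H) {Λ : ProbabilityMeasure F}
    (hΛ : Tendsto (hN.exceedanceLaw hH) atTop (𝓝 Λ)) {m M : F → ℝ≥0} (hm : Continuous m)
    (hM : Continuous M) {C : ℝ≥0} (hC : 0 < C) (hmH : ∀ ω, N ω * m (H ω) ≤ C * N ω)
    (hmΛ : ∀ᵐ x ∂(Λ : Measure F), m x ≤ C) :
    Tendsto (fun u => P.real {ω | u < N ω * m (H ω) ∧ N ω * M (H ω) ≤ u} / P.real {ω | u < N ω})
      atTop (𝓝 (∫ x, max ((m x : ℝ) ^ α - (M x : ℝ) ^ α) 0 ∂(Λ : Measure F))) := by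
  have hC' : (0 : ℝ) < C := hC
  have hCN := hN.const_mul hC'
  have hΛ' : Tendsto (hCN.exceedanceLaw hH) atTop (𝓝 Λ) := by
    refine (hΛ.comp (tendsto_id.const_mul_atTop (inv_pos.2 hC'))).congr fun u => ?_
    exact (hN.exceedanceLaw_const_mul hC' hH u).symm
  have hdiv : ∀ (h : F → ℝ≥0) ω, C * N ω * ((h (H ω) / C : ℝ≥0) : ℝ) = N ω * h (H ω) :=
    fun h ω => by rw [NNReal.coe_div]; field_simp
  have hlim := hCN.tendsto_measureReal_lt_mul_and_mul_le_of_le_one hα (hNm.const_mul _) hH hΛ'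
    (m := fun x => m x / C) (M := fun x => M x / C) (hm.div_const C) (hM.div_const C)
    (fun ω => by rw [hdiv]; exact hmH ω)
    (hmΛ.mono fun x hx => div_le_one_of_le₀ hx zero_le)
  have h := (hN.tendsto_const_mul hC').mul hlim
  simp only [hdiv, ← integral_const_mul, ← max_mul_rpow_sub_mul_rpow,
    mul_div_cancel₀ _ hC.ne'] at h
  refine h.congr fun u => ?_
  rw [div_mul_div_comm, mul_comm, mul_div_mul_right _ _ (hCN.pos u).ne']

end ExceedanceLaw

end HasRegularlyVaryingTail

/-! ### Exponent measures -/

lemma dist_nnreal_smul_zero {E : Type*} [PseudoMetricSpace E] [Zero E] [MulActionWithZero ℝ≥0 E]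
    [IsBoundedSMul ℝ≥0 E] (c : ℝ≥0) (x : E) : dist (c • x) 0 = c * dist x 0 := by
  have hle : ∀ (c : ℝ≥0) (x : E), dist (c • x) 0 ≤ c * dist x 0 := fun c x => by
    simpa only [smul_zero, NNReal.dist_eq, NNReal.coe_zero, sub_zero, NNReal.abs_eq]
      using dist_smul_pair c x (0 : E)
  rcases eq_or_ne c 0 with rfl | hc
  · simp
  refine le_antisymm (hle c x) ?_
  calc (c : ℝ) * dist x 0 = c * dist (c⁻¹ • c • x) 0 := by rw [inv_smul_smul₀ hc]
    _ ≤ c * (↑c⁻¹ * dist (c • x) 0) := by gcongr; exact hle _ _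
    _ = dist (c • x) 0 := by
      rw [NNReal.coe_inv, mul_inv_cancel_left₀ (NNReal.coe_ne_zero.2 hc)]

section SupNorm

variable {K : Type*} [TopologicalSpace K] [CompactSpace K]

lemma supNorm_smul (c : ℝ≥0) (f : CPlus K) : supNorm (c • f) = c * supNorm f :=
  dist_nnreal_smul_zero c f

lemma supNorm_nonneg (f : CPlus K) : 0 ≤ supNorm f := dist_nonneg

lemma supNorm_eq_zero {f : CPlus K} : supNorm f = 0 ↔ f = 0 := dist_eq_zero

lemma continuous_supNorm : Continuous (supNorm : CPlus K → ℝ) :=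
  continuous_id.dist continuous_const

end SupNorm

namespace IsExponentMeasure

variable {K : Type*} [TopologicalSpace K] [CompactSpace K] [MeasurableSpace (CPlus K)]
  [BorelSpace (CPlus K)] [SecondCountableTopology (CPlus K)] {Ω : Type*} [MeasurableSpace Ω]
  {P : Measure Ω} {X : ℤ → Ω → CPlus K} {α : ℝ} {T : Finset ℤ} {a : ℕ → ℝ≥0}
  {μ : Measure (T → CPlus K)}

lemma measure_dist_div_mem (h : IsExponentMeasure P X α T a μ) {y : ℝ} (hy : 0 < y) {B : Set ℝ}
    (hB : MeasurableSet B) :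
    μ {z | dist z 0 / y ∈ B} = ENNReal.ofReal (y ^ (-α)) * μ {z | dist z 0 ∈ B} := by
  lift y to ℝ≥0 using hy.le
  have hy' : 0 < y := hy
  rw [← h.homogeneous y hy' {z | dist z 0 ∈ B}
    ((continuous_id.dist continuous_const).measurable hB)]
  congr 1
  ext z
  rw [Set.mem_smul_set_iff_inv_smul_mem₀ hy'.ne', Set.mem_ofPred_eq, Set.mem_ofPred_eq,
    dist_nnreal_smul_zero, NNReal.coe_inv, inv_mul_eq_div]

lemma measure_lt_dist (h : IsExponentMeasure P X α T a μ) {y : ℝ} (hy : 0 < y) :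
    μ {z | y < dist z 0} = ENNReal.ofReal (y ^ (-α)) * μ {z | 1 < dist z 0} := by
  simpa only [Set.mem_Ioi, one_lt_div hy] using
    h.measure_dist_div_mem hy (measurableSet_Ioi (a := 1))

lemma measure_lt_dist_lt_top (h : IsExponentMeasure P X α T a μ) {y : ℝ} (hy : 0 < y) :
    μ {z | y < dist z 0} < ∞ :=
  h.finite _ (measurableSet_lt measurable_const (by fun_prop)) ⟨y, hy, fun _ hz => le_of_lt hz⟩

lemma measure_one_lt_dist_pos (h : IsExponentMeasure P X α T a μ) :
    0 < μ {z | 1 < dist z 0} := by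
  refine pos_iff_ne_zero.2 fun h0 => h.ne_zero (Measure.measure_univ_eq_zero.1 ?_)
  have hcover : (Set.univ : Set (T → CPlus K)) ⊆
      {0} ∪ ⋃ n : ℕ, {z | 1 / ((n : ℝ) + 1) < dist z 0} := by
    intro z _
    rcases eq_or_ne z 0 with hz | hz
    · exact Or.inl hz
    · exact Or.inr (Set.mem_iUnion.2 (exists_nat_one_div_lt (dist_pos.2 hz)))
  refine measure_mono_null hcover (measure_union_null h.origin (measure_iUnion_null fun n => ?_))
  rw [h.measure_lt_dist Nat.one_div_pos_of_nat, h0, mul_zero]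

-- By homogeneity, if one sphere had positive measure then so would the uncountably many disjoint
-- spheres of radius larger than one, which lie in a set of finite measure.
lemma measure_dist_eq (h : IsExponentMeasure P X α T a μ) {y : ℝ} (hy : 0 < y) :
    μ {z | dist z 0 = y} = 0 := by
  have hmeas : Measurable fun z : T → CPlus K => dist z 0 := by fun_prop
  have hscale : ∀ t, 0 < t →
      μ {z | dist z 0 = t} = ENNReal.ofReal (t ^ (-α)) * μ {z | dist z 0 = 1} := fun t ht => by
    simpa only [Set.mem_singleton_iff, div_eq_one_iff_eq ht.ne'] using
      h.measure_dist_div_mem ht (measurableSet_singleton 1)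
  have : IsFiniteMeasure (μ.restrict {z | 1 < dist z 0}) :=
    ⟨by simpa using h.measure_lt_dist_lt_top one_pos⟩
  have hcount := Measure.countable_meas_level_set_pos (μ := μ.restrict {z | 1 < dist z 0}) hmeas
  rw [hscale y hy]
  by_contra hne
  have hsub : Set.Ioi 1 ⊆ {t | 0 < μ.restrict {z | 1 < dist z 0} {z | dist z 0 = t}} := by
    intro t (ht : 1 < t)
    have hinter : {z : T → CPlus K | dist z 0 = t} ∩ {z | 1 < dist z 0} = {z | dist z 0 = t} :=
      Set.inter_eq_left.2 fun z (hz : dist z 0 = t) => ht.trans_eq hz.symm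
    rw [Set.mem_ofPred_eq, Measure.restrict_apply (measurableSet_eq_fun hmeas measurable_const),
      hinter, hscale t (one_pos.trans ht)]
    exact ENNReal.mul_pos (ENNReal.ofReal_pos.2 (Real.rpow_pos_of_pos (one_pos.trans ht) _)).ne'
      (right_ne_zero_of_mul hne)
  simpa using (hcount.mono hsub).measure_zero volume

lemma tendsto_nat_mul_measureReal (h : IsExponentMeasure P X α T a μ) {y : ℝ}
    (hy : 0 < y) :
    Tendsto (fun n : ℕ => n * P.real {ω | a n * y < dist (fun t : T => X t ω) 0}) atTop
      (𝓝 (μ.real {z | 1 < dist z 0} * y ^ (-α))) := by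
  have hfr : μ (frontier {z | y < dist z 0}) = 0 := by
    refine measure_mono_null (fun z hz => ?_) (h.measure_dist_eq hy)
    exact (frontier_lt_subset_eq continuous_const (by fun_prop) hz).symm
  have hlim := (ENNReal.tendsto_toReal (h.measure_lt_dist_lt_top hy).ne).comp
    (h.tendsto _ (measurableSet_lt measurable_const (by fun_prop))
      ⟨y, hy, fun _ hz => le_of_lt hz⟩ hfr)
  rw [h.measure_lt_dist hy, ENNReal.toReal_mul, ENNReal.toReal_ofReal (by positivity),
    mul_comm] at hlim
  refine hlim.congr' ?_
  filter_upwards [h.tendsto_atTop.eventually_gt_atTop 0] with n hn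
  have hset : {ω | y < dist (fun t : T => (a n)⁻¹ • X t ω) 0}
      = {ω | a n * y < dist (fun t : T => X t ω) 0} := by
    ext ω
    change y < dist ((a n)⁻¹ • fun t : T => X t ω) 0 ↔ _
    rw [dist_nnreal_smul_zero, NNReal.coe_inv, lt_inv_mul_iff₀ (NNReal.coe_pos.2 hn)]
    rfl
  rw [Function.comp_apply, ENNReal.toReal_mul, ENNReal.toReal_natCast, ← hset]
  rfl

lemma hasRegularlyVaryingTail [IsFiniteMeasure P] (h : IsExponentMeasure P X α T a μ) :
    HasRegularlyVaryingTail P (fun ω => dist (fun t : T => X t ω) 0) α :=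
  .of_tendsto_nat_mul (fun _ _ hij => NNReal.coe_le_coe.2 (h.monotone hij))
    (NNReal.tendsto_coe_atTop.2 h.tendsto_atTop)
    (ENNReal.toReal_pos h.measure_one_lt_dist_pos.ne' (h.measure_lt_dist_lt_top one_pos).ne)
    fun _ hy => h.tendsto_nat_mul_measureReal hy

end IsExponentMeasure

lemma IsRegularlyVarying.hasRegularlyVaryingTail {K : Type*} [TopologicalSpace K] [CompactSpace K]
    [MeasurableSpace (CPlus K)] [BorelSpace (CPlus K)] [SecondCountableTopology (CPlus K)]
    {Ω : Type*} [MeasurableSpace Ω] {P : Measure Ω} [IsFiniteMeasure P] {X : ℤ → Ω → CPlus K}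
    {α : ℝ} (hX : IsRegularlyVarying P X α) :
    HasRegularlyVaryingTail P (fun ω => supNorm (X 0 ω)) α := by
  obtain ⟨a, μ, h⟩ := hX.exists_exponentMeasure {0} (Finset.singleton_nonempty 0)
  have hnorm : ∀ ω, dist (fun t : ({0} : Finset ℤ) => X t ω) 0 = supNorm (X 0 ω) := fun ω => by
    rw [dist_pi_def, Finset.univ_unique, Finset.sup_singleton, coe_nndist]
    rfl
  simpa only [hnorm] using h.hasRegularlyVaryingTail

/-! ### The spectral tail process -/

lemma IsRiskFunctional.map_zero {K : Type*} [TopologicalSpace K] {r : CPlus K → ℝ≥0}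
    (hr : IsRiskFunctional r) : r 0 = 0 := by
  simpa only [zero_smul, zero_mul] using hr.homogeneous 0 0

section SpectralTailProcess

variable {K : Type*} [TopologicalSpace K] [CompactSpace K]

lemma IsRiskFunctional.exists_le_mul_supNorm {r : CPlus K → ℝ≥0} (hr : IsRiskFunctional r) :
    ∃ C : ℝ≥0, 0 < C ∧ ∀ f, (r f : ℝ) ≤ C * supNorm f := by
  have hball : ∀ᶠ f in 𝓝 (0 : CPlus K), r f < 1 :=
    hr.continuous.continuousAt.eventually_lt_const (hr.map_zero ▸ one_pos)
  obtain ⟨δ, hδ, hlt⟩ := Metric.eventually_nhds_iff.1 hball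
  lift δ to ℝ≥0 using hδ.le
  have hδ0 : 0 < δ := hδ
  refine ⟨2 / δ, by positivity, fun f => ?_⟩
  rcases (supNorm_nonneg f).eq_or_lt with hf | hf
  · rw [supNorm_eq_zero.1 hf.symm, hr.map_zero, NNReal.coe_zero]
    exact mul_nonneg (NNReal.coe_nonneg _) (supNorm_nonneg _)
  obtain ⟨s, hs⟩ : ∃ s : ℝ≥0, (s : ℝ) = supNorm f := CanLift.prf _ hf.le
  rw [← hs, NNReal.coe_pos] at hf
  have hsmall : supNorm ((δ / (2 * s)) • f) < δ := by
    rw [supNorm_smul, ← hs, ← NNReal.coe_mul, NNReal.coe_lt_coe]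
    field_simp
    exact one_lt_two
  have hr1 : δ / (2 * s) * r f < 1 := hr.homogeneous _ f ▸ hlt hsmall
  rw [← hs, ← NNReal.coe_mul, NNReal.coe_le_coe]
  rw [div_mul_eq_mul_div, div_lt_one (by positivity)] at hr1
  rw [div_mul_eq_mul_div, le_div_iff₀ hδ0, mul_comm]
  exact hr1.le

variable {Ω Ω' : Type*} {X : ℤ → Ω → CPlus K}

/-- The time series `(X_t / ‖X₀‖)_t`, set to zero where `X₀ = 0`. -/
def normalizedSeries (X : ℤ → Ω → CPlus K) (ω : Ω) : ℤ → CPlus K :=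
  fun t => (supNorm (X 0 ω)).toNNReal⁻¹ • X t ω

lemma supNorm_mul_normalizedSeries {m : (ℤ → CPlus K) → ℝ≥0}
    (hm : ∀ (c : ℝ≥0) x, m (c • x) = c * m x) {ω : Ω} (hω : 0 < supNorm (X 0 ω)) :
    supNorm (X 0 ω) * m (normalizedSeries X ω) = m fun t => X t ω := by
  have hsmul : normalizedSeries X ω = (supNorm (X 0 ω)).toNNReal⁻¹ • fun t => X t ω := rfl
  rw [hsmul, hm, NNReal.coe_mul, NNReal.coe_inv, Real.coe_toNNReal _ hω.le,
    mul_inv_cancel_left₀ hω.ne']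

variable [MeasurableSpace (CPlus K)] [MeasurableSpace Ω] [MeasurableSpace Ω'] {P : Measure Ω}
  {P' : Measure Ω'} [IsProbabilityMeasure P'] {Θ : ℤ → Ω' → CPlus K} {α : ℝ}

/-- The law of a spectral tail process, as a probability measure. -/
def IsSpectralTailProcess.law (hΘ : IsSpectralTailProcess P X P' Θ) :
    ProbabilityMeasure (ℤ → CPlus K) :=
  ⟨P'.map fun ω t => Θ t ω,
    Measure.isProbabilityMeasure_map (measurable_pi_lambda _ hΘ.measurable).aemeasurable⟩

lemma IsSpectralTailProcess.ae_law [OpensMeasurableSpace (CPlus K)]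
    (hΘ : IsSpectralTailProcess P X P' Θ) :
    ∀ᵐ x ∂(hΘ.law : Measure (ℤ → CPlus K)), supNorm (x 0) = 1 := by
  refine (ae_map_iff (measurable_pi_lambda _ hΘ.measurable).aemeasurable ?_).2 hΘ.norm_zero
  exact measurableSet_eq_fun (continuous_supNorm.measurable.comp (measurable_pi_apply 0))
    measurable_const

variable [BorelSpace (CPlus K)] [SecondCountableTopology (CPlus K)]

lemma measurable_normalizedSeries (hX : ∀ t, Measurable (X t)) :
    Measurable (normalizedSeries X) :=
  measurable_pi_lambda _ fun t =>
    (continuous_supNorm.measurable.comp (hX 0)).real_toNNReal.inv.smul (hX t)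

lemma IsSpectralTailProcess.tendsto_exceedanceLaw [IsFiniteMeasure P]
    (hΘ : IsSpectralTailProcess P X P' Θ)
    (hN : HasRegularlyVaryingTail P (fun ω => supNorm (X 0 ω)) α) (hX : ∀ t, Measurable (X t)) :
    Tendsto (hN.exceedanceLaw (measurable_normalizedSeries hX)) atTop (𝓝 hΘ.law) := by
  refine tendsto_of_forall_tendsto_map_restrict fun T =>
    ProbabilityMeasure.tendsto_iff_forall_integral_tendsto.2 fun g => ?_
  have hlaw := integral_map_restrict (μ := P') (measurable_pi_lambda _ hΘ.measurable) T g.continuous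
  have hcond := fun u : ℝ => integral_map_restrict (μ := P[|{ω | u < supNorm (X 0 ω)}])
    (measurable_normalizedSeries hX) T g.continuous
  have hlim := hΘ.tendsto T g
  rw [← hlaw] at hlim
  exact hlim.congr fun u => (hcond u).symm

theorem IsSpectralTailProcess.tendsto_measureReal_lt_and_le [IsFiniteMeasure P]
    (hΘ : IsSpectralTailProcess P X P' Θ) (hα : 0 < α)
    (hN : HasRegularlyVaryingTail P (fun ω => supNorm (X 0 ω)) α) (hX : ∀ t, Measurable (X t))
    {m M : (ℤ → CPlus K) → ℝ≥0} (hm : Continuous m) (hM : Continuous M)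
    (hm_smul : ∀ (c : ℝ≥0) x, m (c • x) = c * m x)
    (hM_smul : ∀ (c : ℝ≥0) x, M (c • x) = c * M x) {C : ℝ≥0} (hC : 0 < C)
    (hle : ∀ x, (m x : ℝ) ≤ C * supNorm (x 0)) :
    Tendsto (fun u : ℝ => P.real {ω | u < m (fun t => X t ω) ∧ M (fun t => X t ω) ≤ u}
      / P.real {ω | u < supNorm (X 0 ω)}) atTop
      (𝓝 (∫ x, max ((m x : ℝ) ^ α - (M x : ℝ) ^ α) 0 ∂(hΘ.law : Measure (ℤ → CPlus K)))) := by
  have hNm : Measurable fun ω => supNorm (X 0 ω) := continuous_supNorm.measurable.comp (hX 0)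
  have hlim := hN.tendsto_measureReal_lt_mul_and_mul_le hα hNm (measurable_normalizedSeries hX)
    (hΘ.tendsto_exceedanceLaw hN hX) hm hM hC ?_ ?_
  · refine hlim.congr' ?_
    filter_upwards [eventually_ge_atTop 0] with u hu
    congr 2
    ext ω
    rcases (supNorm_nonneg (X 0 ω)).eq_or_lt with h0 | h0
    · have hmX : ((m fun t => X t ω : ℝ≥0) : ℝ) ≤ 0 := (hle _).trans_eq (by rw [← h0, mul_zero])
      simp only [Set.mem_ofPred_eq, ← h0, zero_mul, not_lt.2 hu, not_lt.2 (hmX.trans hu),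
        false_and]
    · simp only [Set.mem_ofPred_eq, supNorm_mul_normalizedSeries hm_smul h0,
        supNorm_mul_normalizedSeries hM_smul h0]
  · intro ω
    rcases (supNorm_nonneg (X 0 ω)).eq_or_lt with h0 | h0
    · simp only [← h0, zero_mul, mul_zero, le_refl]
    · rw [supNorm_mul_normalizedSeries hm_smul h0]
      exact hle _
  · filter_upwards [hΘ.ae_law] with x hx
    exact NNReal.coe_le_coe.1 ((hle x).trans_eq (by rw [hx, mul_one]))

end SpectralTailProcess

/-! ### The law of the risk-normalized spectral process -/

section RiskSpectralLaw

variable {K : Type*} [TopologicalSpace K] [MeasurableSpace (CPlus K)] [BorelSpace (CPlus K)]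
  {r : CPlus K → ℝ≥0} {α : ℝ} {Q : Measure (ℤ → CPlus K)}

lemma IsRiskFunctional.measurable_eval (hr : IsRiskFunctional r) (t : ℤ) :
    Measurable fun θ : ℤ → CPlus K => r (θ t) :=
  hr.continuous.measurable.comp (measurable_pi_apply t)

lemma IsRiskFunctional.measurable_rpow_eval (hr : IsRiskFunctional r) (α : ℝ) (t : ℤ) :
    Measurable fun θ : ℤ → CPlus K => (r (θ t) : ℝ) ^ α :=
  (hr.measurable_eval t).coe_nnreal_real.pow_const α

lemma IsRiskFunctional.toReal_lintegral_rpow (hr : IsRiskFunctional r) (α : ℝ)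
    (Q : Measure (ℤ → CPlus K)) :
    (∫⁻ θ, ((r (θ 0) ^ α : ℝ≥0) : ℝ≥0∞) ∂Q).toReal = ∫ θ, (r (θ 0) : ℝ) ^ α ∂Q := by
  rw [integral_eq_lintegral_of_nonneg_ae (Eventually.of_forall fun θ => by positivity)
    (hr.measurable_rpow_eval α 0).aestronglyMeasurable]
  simp only [← NNReal.coe_rpow, ENNReal.ofReal_coe_nnreal]

variable [SecondCountableTopology (CPlus K)]

lemma IsRiskFunctional.measurable_inv_smul (hr : IsRiskFunctional r) :
    Measurable fun (θ : ℤ → CPlus K) (t : ℤ) => (r (θ 0))⁻¹ • θ t :=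
  measurable_pi_lambda _ fun t => (hr.measurable_eval 0).inv.smul (measurable_pi_apply t)

lemma isProbabilityMeasure_riskSpectralLaw (hr : IsRiskFunctional r)
    (hpos : 0 < ∫ θ, (r (θ 0) : ℝ) ^ α ∂Q) : IsProbabilityMeasure (riskSpectralLaw r α Q) := by
  rw [← hr.toReal_lintegral_rpow, ENNReal.toReal_pos_iff] at hpos
  refine ⟨?_⟩
  rw [riskSpectralLaw, Measure.map_apply hr.measurable_inv_smul MeasurableSet.univ,
    Set.preimage_univ, Measure.smul_apply, withDensity_apply _ MeasurableSet.univ,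
    Measure.restrict_univ, smul_eq_mul, ENNReal.inv_mul_cancel hpos.1.ne' hpos.2.ne]

lemma ae_riskSpectralLaw_eq_one (hr : IsRiskFunctional r) (hα : α ≠ 0) :
    ∀ᵐ θ ∂(riskSpectralLaw r α Q), r (θ 0) = 1 := by
  rw [riskSpectralLaw, ae_map_iff hr.measurable_inv_smul.aemeasurable
    (measurableSet_eq_fun (hr.measurable_eval 0) measurable_const)]
  refine Measure.ae_smul_measure ?_ _
  rw [ae_withDensity_iff ((hr.measurable_eval 0).pow_const α).coe_nnreal_ennreal]
  refine Eventually.of_forall fun θ hθ => ?_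
  have h0 : r (θ 0) ≠ 0 := fun h => hθ (by rw [h, NNReal.zero_rpow hα, ENNReal.coe_zero])
  rw [hr.homogeneous, inv_mul_cancel₀ h0]

lemma integral_riskSpectralLaw (hr : IsRiskFunctional r) {F : (ℤ → CPlus K) → ℝ}
    (hF : Measurable F) (hF_smul : ∀ (c : ℝ≥0) θ, F (c • θ) = (c : ℝ) ^ α * F θ)
    (hF_zero : ∀ θ, r (θ 0) = 0 → F θ = 0) :
    ∫ θ, F θ ∂(riskSpectralLaw r α Q) = (∫ θ, (r (θ 0) : ℝ) ^ α ∂Q)⁻¹ * ∫ θ, F θ ∂Q := by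
  rw [riskSpectralLaw, integral_map hr.measurable_inv_smul.aemeasurable hF.aestronglyMeasurable,
    integral_smul_measure, ENNReal.toReal_inv, hr.toReal_lintegral_rpow, smul_eq_mul,
    integral_withDensity_eq_integral_smul ((hr.measurable_eval 0).pow_const α)]
  congr 2 with θ
  change ((r (θ 0) ^ α : ℝ≥0) : ℝ) * F ((r (θ 0))⁻¹ • θ) = F θ
  rw [hF_smul]
  rcases eq_or_ne (r (θ 0)) 0 with h0 | h0
  · rw [hF_zero θ h0, mul_zero, mul_zero]
  · rw [NNReal.coe_inv, Real.inv_rpow (NNReal.coe_nonneg _), NNReal.coe_rpow,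
      mul_inv_cancel_left₀ (by positivity)]

lemma integral_rpow_mul_integral_riskSpectralLaw (hr : IsRiskFunctional r) (hα : α ≠ 0)
    (hpos : 0 < ∫ θ, (r (θ 0) : ℝ) ^ α ∂Q) {m M : (ℤ → CPlus K) → ℝ≥0}
    (hm : Measurable m) (hM : Measurable M) (hm_smul : ∀ (c : ℝ≥0) x, m (c • x) = c * m x)
    (hM_smul : ∀ (c : ℝ≥0) x, M (c • x) = c * M x) (hle : ∀ x, m x ≤ r (x 0)) :
    (∫ θ, (r (θ 0) : ℝ) ^ α ∂Q)
        * ∫ θ, max ((m θ : ℝ) ^ α - (M θ : ℝ) ^ α) 0 ∂(riskSpectralLaw r α Q)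
      = ∫ θ, max ((m θ : ℝ) ^ α - (M θ : ℝ) ^ α) 0 ∂Q := by
  rw [integral_riskSpectralLaw hr, mul_inv_cancel_left₀ hpos.ne']
  · exact ((hm.coe_nnreal_real.pow_const α).sub (hM.coe_nnreal_real.pow_const α)).max
      measurable_const
  · intro c θ
    rw [hm_smul, hM_smul, max_mul_rpow_sub_mul_rpow]
  · intro θ h0
    have hmθ : m θ = 0 := le_antisymm ((hle θ).trans_eq h0) zero_le
    rw [hmθ, NNReal.coe_zero, Real.zero_rpow hα, zero_sub,
      max_eq_right (neg_nonpos.2 (by positivity))]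

end RiskSpectralLaw

/-! ### Clusters in terms of minimal and boundary risks -/

section ClusterRisks

variable {K : Type*} [TopologicalSpace K] {r : CPlus K → ℝ≥0} {ℓ : ℕ}

/-- The minimum of the risks at the times `0, …, ℓ - 1` of a potential cluster of size `ℓ ≥ 1`
(the risk at time `0` if `ℓ = 0`). -/
def minRisk (r : CPlus K → ℝ≥0) (ℓ : ℕ) (x : ℤ → CPlus K) : ℝ≥0 :=
  (Finset.Ico 1 ℓ).fold min (r (x 0)) fun i : ℕ => r (x i)

/-- The maximum of the risks right before and right after a potential cluster at the times
`0, …, ℓ - 1`. -/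
def boundaryRisk (r : CPlus K → ℝ≥0) (ℓ : ℕ) (x : ℤ → CPlus K) : ℝ≥0 :=
  max (r (x (-1))) (r (x ℓ))

lemma minRisk_le (r : CPlus K → ℝ≥0) (ℓ : ℕ) (x : ℤ → CPlus K) : minRisk r ℓ x ≤ r (x 0) :=
  (Finset.fold_min_le _).2 (Or.inl le_rfl)

lemma IsRiskFunctional.continuous_eval (hr : IsRiskFunctional r) (t : ℤ) :
    Continuous fun x : ℤ → CPlus K => r (x t) :=
  hr.continuous.comp (continuous_apply t)

lemma continuous_minRisk (hr : IsRiskFunctional r) (ℓ : ℕ) : Continuous (minRisk r ℓ) := by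
  unfold minRisk
  induction Finset.Ico 1 ℓ using Finset.induction_on with
  | empty => simpa only [Finset.fold_empty] using hr.continuous_eval 0
  | insert i s hi ih =>
    simp only [Finset.fold_insert hi]
    exact (hr.continuous_eval i).min ih

lemma continuous_boundaryRisk (hr : IsRiskFunctional r) (ℓ : ℕ) :
    Continuous (boundaryRisk r ℓ) :=
  (hr.continuous_eval (-1)).max (hr.continuous_eval ℓ)

lemma minRisk_smul (hr : IsRiskFunctional r) (c : ℝ≥0) (x : ℤ → CPlus K) :
    minRisk r ℓ (c • x) = c * minRisk r ℓ x := by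
  simp only [minRisk, Pi.smul_apply, hr.homogeneous]
  exact Finset.fold_hom fun y z => mul_min c y z

lemma boundaryRisk_smul (hr : IsRiskFunctional r) (c : ℝ≥0) (x : ℤ → CPlus K) :
    boundaryRisk r ℓ (c • x) = c * boundaryRisk r ℓ x := by
  simp only [boundaryRisk, Pi.smul_apply, hr.homogeneous, mul_max]

lemma coe_minRisk_rpow {α : ℝ} (hα : 0 ≤ α) (x : ℤ → CPlus K) :
    (minRisk r ℓ x : ℝ) ^ α
      = (Finset.Ico 1 ℓ).fold min ((r (x 0) : ℝ) ^ α) fun i : ℕ => (r (x i) : ℝ) ^ α := by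
  have hmono : Monotone fun y : ℝ≥0 => (y : ℝ) ^ α := fun y z hyz =>
    Real.rpow_le_rpow y.coe_nonneg hyz hα
  exact (Finset.fold_hom (m := fun y : ℝ≥0 => (y : ℝ) ^ α) fun y z => hmono.map_min).symm

lemma coe_boundaryRisk_rpow {α : ℝ} (hα : 0 ≤ α) (x : ℤ → CPlus K) :
    (boundaryRisk r ℓ x : ℝ) ^ α = max ((r (x (-1)) : ℝ) ^ α) ((r (x ℓ) : ℝ) ^ α) := by
  have hmono : Monotone fun y : ℝ≥0 => (y : ℝ) ^ α := fun y z hyz =>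
    Real.rpow_le_rpow y.coe_nonneg hyz hα
  exact hmono.map_max

lemma lt_minRisk (hℓ : 1 ≤ ℓ) {x : ℤ → CPlus K} {u : ℝ} :
    u < minRisk r ℓ x ↔ ∀ i : ℕ, i < ℓ → u < r (x i) := by
  have hfold : (minRisk r ℓ x : ℝ)
      = (Finset.Ico 1 ℓ).fold min (r (x 0) : ℝ) fun i : ℕ => (r (x i) : ℝ) :=
    (Finset.fold_hom NNReal.coe_min).symm
  rw [hfold, Finset.lt_fold_min]
  refine ⟨fun ⟨h0, h⟩ i hi => ?_, fun h => ⟨h 0 hℓ, fun i hi => h i (Finset.mem_Ico.1 hi).2⟩⟩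
  rcases i.eq_zero_or_pos with rfl | hi0
  · exact h0
  · exact h i (Finset.mem_Ico.2 ⟨hi0, hi⟩)

lemma isCluster_iff (hℓ : 1 ≤ ℓ) {x : ℤ → CPlus K} {u : ℝ} :
    IsCluster (fun t => (r (x t) : ℝ)) u 0 ℓ ↔
      u < minRisk r ℓ x ∧ boundaryRisk r ℓ x ≤ u := by
  rw [lt_minRisk hℓ, boundaryRisk, NNReal.coe_max, max_le_iff, and_left_comm]
  simp only [IsCluster, zero_add, zero_sub]

lemma isCluster_mul_iff (hr : IsRiskFunctional r) (hℓ : 1 ≤ ℓ) {x : ℤ → CPlus K} {u v : ℝ}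
    (hu : 0 ≤ u) :
    IsCluster (fun t => v * (r (x t) : ℝ)) u 0 ℓ ↔
      u < v * minRisk r ℓ x ∧ v * boundaryRisk r ℓ x ≤ u := by
  rcases le_or_gt v 0 with hv | hv
  · have hle : ∀ y : ℝ≥0, v * y ≤ u := fun y =>
      (mul_nonpos_of_nonpos_of_nonneg hv y.coe_nonneg).trans hu
    exact ⟨fun h => absurd (h.2.1 0 hℓ) (hle _).not_gt, fun h => absurd h.1 (hle _).not_gt⟩
  · lift v to ℝ≥0 using hv.le
    simpa only [Pi.smul_apply, hr.homogeneous, minRisk_smul hr, boundaryRisk_smul hr,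
      NNReal.coe_mul] using isCluster_iff (r := r) hℓ (x := v • x) (u := u)

variable [MeasurableSpace (CPlus K)] {α : ℝ} {Q : Measure (ℤ → CPlus K)}

lemma limitNumerator_eq_integral (hα : 0 ≤ α) (hone : ∀ᵐ θ ∂Q, r (θ 0) = 1) (ℓ : ℕ) :
    limitNumerator r α Q ℓ
      = ∫ θ, max ((minRisk r ℓ θ : ℝ) ^ α - (boundaryRisk r ℓ θ : ℝ) ^ α) 0 ∂Q := by
  refine integral_congr_ae ?_
  filter_upwards [hone] with θ hθ
  rw [coe_minRisk_rpow hα, coe_boundaryRisk_rpow hα, hθ, NNReal.coe_one, Real.one_rpow]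

lemma limitDenominator_eq_integral (hone : ∀ᵐ θ ∂Q, r (θ 0) = 1) :
    limitDenominator r α Q
      = ∫ θ, max ((r (θ 0) : ℝ) ^ α - (r (θ (-1)) : ℝ) ^ α) 0 ∂Q := by
  refine integral_congr_ae ?_
  filter_upwards [hone] with θ hθ
  rw [hθ, NNReal.coe_one, Real.one_rpow]

end ClusterRisks

/-! ### Long clusters of a stationary sequence -/

/-- A `u`-exceedance cluster of size larger than `n` starts at time `t`. -/
def LongClusterStarts (R : ℤ → ℝ) (u : ℝ) (t : ℤ) (n : ℕ) : Prop :=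
  R (t - 1) ≤ u ∧ ∀ i : ℕ, i ≤ n → u < R (t + i)

lemma longClusterStarts_zero_iff {R : ℤ → ℝ} {u : ℝ} {t : ℤ} :
    LongClusterStarts R u t 0 ↔ ClusterStarts R u t := by
  simp only [LongClusterStarts, ClusterStarts, nonpos_iff_eq_zero, forall_eq, Nat.cast_zero,
    add_zero]

lemma longClusterStarts_comp_add_iff {R : ℤ → ℝ} {u : ℝ} {t : ℤ} {n : ℕ} :
    LongClusterStarts (fun s => R (s + t)) u 0 n ↔ LongClusterStarts R u t n := by
  simp only [LongClusterStarts, zero_add, add_comm _ t, sub_eq_add_neg]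

lemma longClusterStarts_succ_iff {R : ℤ → ℝ} {u : ℝ} {t : ℤ} {n : ℕ} :
    LongClusterStarts R u t (n + 1) ↔
      LongClusterStarts R u t n ∧ u < R (t + (n + 1 : ℕ)) := by
  simp only [LongClusterStarts, Nat.le_succ_iff, or_imp, forall_and, forall_eq, and_assoc]

lemma isCluster_succ_iff {R : ℤ → ℝ} {u : ℝ} {t : ℤ} {n : ℕ} :
    IsCluster R u t (n + 1) ↔ LongClusterStarts R u t n ∧ ¬ LongClusterStarts R u t (n + 1) := by
  rw [longClusterStarts_succ_iff]
  simp only [IsCluster, LongClusterStarts, Nat.lt_succ_iff, ← not_lt]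
  tauto

lemma not_longClusterStarts_of_lt {R : ℤ → ℝ} {u : ℝ} {s t : ℤ} {n : ℕ} (hst : s < t)
    (htn : t ≤ s + n + 1) (hs : LongClusterStarts R u s n) : ¬ LongClusterStarts R u t n := by
  intro ht
  have hexc := hs.2 (t - 1 - s).toNat (by omega)
  rw [Int.toNat_of_nonneg (by omega), add_sub_cancel] at hexc
  exact hexc.not_ge ht.1

section Stationary

variable {Ω : Type*} [MeasurableSpace Ω] {P : Measure Ω}

lemma IsStationary.comp {E F : Type*} [MeasurableSpace E] [MeasurableSpace F]
    {X : ℤ → Ω → E} (hX : IsStationary P X) {f : E → F} (hf : Measurable f) :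
    IsStationary P fun t ω => f (X t ω) where
  measurable t := hf.comp (hX.measurable t)
  map_shift h := by
    have hF : Measurable fun (x : ℤ → E) (t : ℤ) => f (x t) :=
      measurable_pi_lambda _ fun t => hf.comp (measurable_pi_apply t)
    have hmap := congrArg (Measure.map fun (x : ℤ → E) (t : ℤ) => f (x t)) (hX.map_shift h)
    rwa [Measure.map_map hF (measurable_pi_lambda _ fun t => hX.measurable _),
      Measure.map_map hF (measurable_pi_lambda _ hX.measurable)] at hmap

lemma IsStationary.measureReal_shift_mem {E : Type*} [MeasurableSpace E] {X : ℤ → Ω → E}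
    (hX : IsStationary P X) (h : ℤ) {A : Set (ℤ → E)} (hA : MeasurableSet A) :
    P.real {ω | (fun t => X (t + h) ω) ∈ A} = P.real {ω | (fun t => X t ω) ∈ A} := by
  have hmap := congrArg (fun μ : Measure (ℤ → E) => μ.real A) (hX.map_shift h)
  rwa [map_measureReal_apply (measurable_pi_lambda _ fun t => hX.measurable _) hA,
    map_measureReal_apply (measurable_pi_lambda _ hX.measurable) hA] at hmap

lemma measurableSet_longClusterStarts (u : ℝ) (t : ℤ) (n : ℕ) :
    MeasurableSet {x : ℤ → ℝ | LongClusterStarts x u t n} := by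
  simp only [LongClusterStarts]
  measurability

variable {R : ℤ → Ω → ℝ}

lemma IsStationary.measureReal_longClusterStarts (hR : IsStationary P R) (u : ℝ) (t : ℤ) (n : ℕ) :
    P.real {ω | LongClusterStarts (fun s => R s ω) u t n}
      = P.real {ω | LongClusterStarts (fun s => R s ω) u 0 n} := by
  refine Eq.trans ?_ (hR.measureReal_shift_mem t (measurableSet_longClusterStarts u 0 n))
  congr with ω
  exact longClusterStarts_comp_add_iff.symm

variable [IsFiniteMeasure P]

lemma IsStationary.mul_measureReal_longClusterStarts_le (hR : IsStationary P R) (u : ℝ) (n : ℕ) :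
    ((n : ℝ) + 1) * P.real {ω | LongClusterStarts (fun s => R s ω) u 0 n}
      ≤ P.real {ω | u < R 0 ω} := by
  let A : ℕ → Set Ω := fun k => {ω | LongClusterStarts (fun s => R s ω) u (-k) n}
  have hdisj : (Finset.range (n + 1) : Set ℕ).PairwiseDisjoint A := by
    intro j hj k hk hjk
    simp only [Finset.coe_range, Set.mem_Iio] at hj hk
    refine Set.disjoint_left.2 fun ω
      (hωj : LongClusterStarts (fun s => R s ω) u (-j) n)
      (hωk : LongClusterStarts (fun s => R s ω) u (-k) n) => ?_
    rcases lt_or_gt_of_ne hjk with h | h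
    · exact not_longClusterStarts_of_lt (by omega) (by omega) hωk hωj
    · exact not_longClusterStarts_of_lt (by omega) (by omega) hωj hωk
  have hmeas : ∀ k, MeasurableSet (A k) := fun k =>
    (measurable_pi_lambda _ hR.measurable) (measurableSet_longClusterStarts u (-k) n)
  calc ((n : ℝ) + 1) * P.real {ω | LongClusterStarts (fun s => R s ω) u 0 n}
      = ∑ k ∈ Finset.range (n + 1), P.real (A k) := by
        simp only [A, hR.measureReal_longClusterStarts, Finset.sum_const, Finset.card_range,
          nsmul_eq_mul, Nat.cast_add, Nat.cast_one]
    _ = P.real (⋃ k ∈ Finset.range (n + 1), A k) :=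
        (measureReal_biUnion_finset hdisj fun k _ => hmeas k).symm
    _ ≤ P.real {ω | u < R 0 ω} :=
        measureReal_mono <| Set.iUnion₂_subset fun k hk ω hω => by
          simpa only [neg_add_cancel, Set.mem_ofPred_eq]
            using hω.2 k (Nat.lt_succ_iff.1 (Finset.mem_range.1 hk))

lemma measureReal_isCluster_succ (hR : ∀ t, Measurable (R t)) (u : ℝ) (n : ℕ) :
    P.real {ω | IsCluster (fun t => R t ω) u 0 (n + 1)}
      = P.real {ω | LongClusterStarts (fun t => R t ω) u 0 n}
        - P.real {ω | LongClusterStarts (fun t => R t ω) u 0 (n + 1)} := by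
  rw [← measureReal_sdiff]
  · congr with ω
    exact isCluster_succ_iff
  · exact fun ω h => ⟨h.1, fun i hi => h.2 i (hi.trans n.le_succ)⟩
  · exact (measurable_pi_lambda _ hR) (measurableSet_longClusterStarts u 0 (n + 1))

lemma sum_measureReal_isCluster (hR : ∀ t, Measurable (R t)) (u : ℝ) (n : ℕ) :
    ∑ k ∈ Finset.range n, P.real {ω | IsCluster (fun t => R t ω) u 0 (k + 1)}
      = P.real {ω | ClusterStarts (fun t => R t ω) u 0}
        - P.real {ω | LongClusterStarts (fun t => R t ω) u 0 n} := by
  simp only [measureReal_isCluster_succ hR, ← longClusterStarts_zero_iff]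
  exact Finset.sum_range_sub' _ n

end Stationary

/-! ### Monotone transforms -/

section Transform

variable {φ : ℝ → ℝ} {wstar : EReal}

namespace IsMarginalTransform

lemma exists_mem_below_eq (hφ : IsMarginalTransform φ wstar) {u : ℝ} (hu : 0 < u) :
    ∃ w ∈ below wstar, φ w = u :=
  (hφ.bijOn.surjOn hu).imp fun _ hw => ⟨hw.1.1, hw.2⟩

lemma transformInv_mem (hφ : IsMarginalTransform φ wstar) {u : ℝ} (hu : 0 < u) :
    transformInv φ wstar u ∈ below wstar :=
  Function.invFunOn_mem (hφ.exists_mem_below_eq hu)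

lemma apply_transformInv (hφ : IsMarginalTransform φ wstar) {u : ℝ} (hu : 0 < u) :
    φ (transformInv φ wstar u) = u :=
  Function.invFunOn_eq (hφ.exists_mem_below_eq hu)

lemma transformInv_lt_iff (hφ : IsMarginalTransform φ wstar) {u : ℝ} (hu : 0 < u) {w : ℝ}
    (hw : w ∈ below wstar) : transformInv φ wstar u < w ↔ u < φ w := by
  have hmem := hφ.transformInv_mem hu
  have happly := hφ.apply_transformInv hu
  constructor <;> intro h
  · have hle : u ≤ φ w := happly.symm.trans_le (hφ.monotoneOn hmem hw h.le)
    refine hle.lt_of_ne fun heq => h.ne ?_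
    exact hφ.bijOn.injOn ⟨hmem, hu.trans_eq happly.symm⟩ ⟨hw, hu.trans_eq heq⟩ (happly.trans heq)
  · by_contra! hle
    exact ((hφ.monotoneOn hw hmem hle).trans_eq happly).not_gt h

lemma tendsto_transformInv (hφ : IsMarginalTransform φ wstar) :
    Tendsto (fun u : ℝ => (transformInv φ wstar u : EReal)) atTop (𝓝 wstar) := by
  refine tendsto_order.2 ⟨fun b hb => ?_, fun b hb => ?_⟩
  · obtain ⟨c, hbc, hcw⟩ := EReal.lt_iff_exists_real_btwn.1 hb
    filter_upwards [eventually_ge_atTop (φ c), eventually_gt_atTop 0] with u hu hu0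
    have hc : c ≤ transformInv φ wstar u :=
      not_lt.1 fun h => hu.not_gt ((hφ.transformInv_lt_iff hu0 hcw).1 h)
    exact hbc.trans_le (EReal.coe_le_coe_iff.2 hc)
  · filter_upwards [eventually_gt_atTop 0] with u hu
    exact (hφ.transformInv_mem hu).trans hb

end IsMarginalTransform

lemma clusterSizeProb_congr {Ω : Type*} [MeasurableSpace Ω] {P : Measure Ω} {R R' : ℤ → Ω → ℝ}
    {u u' : ℝ} (h : ∀ᵐ ω ∂P, ∀ t, u < R t ω ↔ u' < R' t ω) (ℓ : ℕ) :
    clusterSizeProb P R u ℓ = clusterSizeProb P R' u' ℓ := by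
  unfold clusterSizeProb
  congr 1 <;> refine measureReal_congr (eventuallyEq_set.2 ?_) <;> filter_upwards [h] with ω hω
  · simp only [IsCluster, hω, ← not_lt]
  · simp only [ClusterStarts, hω, ← not_lt]

theorem clusterSizeProb_transformInv {K : Type*} [TopologicalSpace K] {Ω : Type*}
    [MeasurableSpace Ω] {P : Measure Ω} {X : ℤ → Ω → CPlus K} {W : ℤ → Ω → C(K, ℝ)}
    {r : CPlus K → ℝ≥0} {rho : C(K, ℝ) → ℝ} (hφ : IsMarginalTransform φ wstar)
    (hW : ∀ᵐ ω ∂P, ∀ t s, W t ω s ∈ below wstar ∧ (X t ω s : ℝ) = φ (W t ω s))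
    (hrho : CommutesWith r rho φ wstar) {u : ℝ} (hu : 0 < u) (ℓ : ℕ) :
    clusterSizeProb P (fun t ω => rho (W t ω)) (transformInv φ wstar u) ℓ
      = clusterSizeProb P (fun t ω => (r (X t ω) : ℝ)) u ℓ := by
  refine clusterSizeProb_congr ?_ ℓ
  filter_upwards [hW] with ω hω t
  obtain ⟨hmem, happly⟩ := hrho (W t ω) fun s => (hω t s).1
  rw [hφ.transformInv_lt_iff hu hmem, happly (X t ω) fun s => (hω t s).2]

end Transform

/-! ### The limit of the cluster size distribution -/

section ClusterSizeLimit

variable {K : Type*} [TopologicalSpace K] [MeasurableSpace (CPlus K)] [BorelSpace (CPlus K)]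
  {r : CPlus K → ℝ≥0} {α : ℝ}

lemma clusterSizeProb_paretoMeasure_prod (hα : 0 < α) (hr : IsRiskFunctional r)
    [SecondCountableTopology (CPlus K)] {Q : Measure (ℤ → CPlus K)} [IsProbabilityMeasure Q]
    (hone : ∀ᵐ θ ∂Q, r (θ 0) = 1) {ℓ : ℕ} (hℓ : 1 ≤ ℓ) :
    clusterSizeProb ((paretoMeasure 1 α).prod Q) (fun t p => p.1 * (r (p.2 t) : ℝ)) 1 ℓ
      = limitNumerator r α Q ℓ / limitDenominator r α Q := by
  have hle : ∀ᵐ θ ∂Q, r (θ 0) ≤ 1 := hone.mono fun θ h => h.le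
  rw [limitNumerator_eq_integral hα.le hone, limitDenominator_eq_integral hone,
    ← paretoMeasure_prod_real_one_lt_mul_and hα (continuous_minRisk hr ℓ).measurable
      (continuous_boundaryRisk hr ℓ).measurable (hle.mono fun θ h => (minRisk_le r ℓ θ).trans h),
    ← paretoMeasure_prod_real_one_lt_mul_and hα (hr.measurable_eval 0) (hr.measurable_eval (-1))
      hle, clusterSizeProb]
  simp only [isCluster_mul_iff hr hℓ zero_le_one, ClusterStarts, zero_sub, and_comm]

variable {Ω Ω' : Type*} [MeasurableSpace Ω] [MeasurableSpace Ω'] {P : Measure Ω}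
  {P' : Measure Ω'} [IsProbabilityMeasure P'] {X : ℤ → Ω → CPlus K} {Θ : ℤ → Ω' → CPlus K}
  [CompactSpace K]

lemma IsSpectralTailProcess.integral_rpow_law (hΘ : IsSpectralTailProcess P X P' Θ)
    (hr : IsRiskFunctional r) :
    ∫ θ, (r (θ 0) : ℝ) ^ α ∂(hΘ.law : Measure (ℤ → CPlus K))
      = ∫ ω, (r (Θ 0 ω) : ℝ) ^ α ∂P' :=
  integral_map (measurable_pi_lambda _ hΘ.measurable).aemeasurable
    (hr.measurable_rpow_eval α 0).aestronglyMeasurable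

variable [SecondCountableTopology (CPlus K)] [IsFiniteMeasure P]
  (hΘ : IsSpectralTailProcess P X P' Θ) (hα : 0 < α)
  (hN : HasRegularlyVaryingTail P (fun ω => supNorm (X 0 ω)) α) (hr : IsRiskFunctional r)
  (hpos : 0 < ∫ θ, (r (θ 0) : ℝ) ^ α ∂(hΘ.law : Measure (ℤ → CPlus K)))
include hα hN hr hpos

lemma IsSpectralTailProcess.tendsto_measureReal_riskSpectralLaw (hX : ∀ t, Measurable (X t))
    {m M : (ℤ → CPlus K) → ℝ≥0} (hm : Continuous m) (hM : Continuous M)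
    (hm_smul : ∀ (c : ℝ≥0) x, m (c • x) = c * m x)
    (hM_smul : ∀ (c : ℝ≥0) x, M (c • x) = c * M x) (hle : ∀ x, m x ≤ r (x 0)) :
    Tendsto (fun u : ℝ => P.real {ω | u < m (fun t => X t ω) ∧ M (fun t => X t ω) ≤ u}
      / P.real {ω | u < supNorm (X 0 ω)}) atTop
      (𝓝 ((∫ θ, (r (θ 0) : ℝ) ^ α ∂(hΘ.law : Measure (ℤ → CPlus K)))
        * ∫ θ, max ((m θ : ℝ) ^ α - (M θ : ℝ) ^ α) 0 ∂(riskSpectralLaw r α hΘ.law))) := by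
  obtain ⟨C, hC, hrC⟩ := hr.exists_le_mul_supNorm
  rw [integral_rpow_mul_integral_riskSpectralLaw hr hα.ne' hpos hm.measurable hM.measurable
    hm_smul hM_smul hle]
  exact hΘ.tendsto_measureReal_lt_and_le hα hN hX hm hM hm_smul hM_smul hC fun x =>
    (NNReal.coe_le_coe.2 (hle x)).trans (hrC _)

lemma IsSpectralTailProcess.tendsto_measureReal_isCluster (hX : ∀ t, Measurable (X t)) {ℓ : ℕ}
    (hℓ : 1 ≤ ℓ) :
    Tendsto (fun u : ℝ => P.real {ω | IsCluster (fun t => (r (X t ω) : ℝ)) u 0 ℓ}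
      / P.real {ω | u < supNorm (X 0 ω)}) atTop
      (𝓝 ((∫ θ, (r (θ 0) : ℝ) ^ α ∂(hΘ.law : Measure (ℤ → CPlus K)))
        * limitNumerator r α (riskSpectralLaw r α hΘ.law) ℓ)) := by
  rw [limitNumerator_eq_integral hα.le (ae_riskSpectralLaw_eq_one hr hα.ne')]
  simp only [isCluster_iff hℓ (x := fun t => X t _)]
  exact hΘ.tendsto_measureReal_riskSpectralLaw hα hN hr hpos hX (continuous_minRisk hr ℓ)
    (continuous_boundaryRisk hr ℓ) (minRisk_smul hr) (boundaryRisk_smul hr) (minRisk_le r ℓ)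

lemma IsSpectralTailProcess.tendsto_measureReal_clusterStarts (hX : ∀ t, Measurable (X t)) :
    Tendsto (fun u : ℝ => P.real {ω | ClusterStarts (fun t => (r (X t ω) : ℝ)) u 0}
      / P.real {ω | u < supNorm (X 0 ω)}) atTop
      (𝓝 ((∫ θ, (r (θ 0) : ℝ) ^ α ∂(hΘ.law : Measure (ℤ → CPlus K)))
        * limitDenominator r α (riskSpectralLaw r α hΘ.law))) := by
  rw [limitDenominator_eq_integral (ae_riskSpectralLaw_eq_one hr hα.ne')]
  simp only [ClusterStarts, zero_sub, and_comm (a := (_ : ℝ) ≤ _)]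
  exact hΘ.tendsto_measureReal_riskSpectralLaw hα hN hr hpos hX (hr.continuous_eval 0)
    (hr.continuous_eval (-1)) (fun c _ => hr.homogeneous c _) (fun c _ => hr.homogeneous c _)
    fun _ => le_rfl

lemma IsSpectralTailProcess.tendsto_measureReal_longClusterStarts (hX : ∀ t, Measurable (X t))
    (n : ℕ) :
    Tendsto (fun u : ℝ => P.real {ω | LongClusterStarts (fun t => (r (X t ω) : ℝ)) u 0 n}
      / P.real {ω | u < supNorm (X 0 ω)}) atTop
      (𝓝 ((∫ θ, (r (θ 0) : ℝ) ^ α ∂(hΘ.law : Measure (ℤ → CPlus K)))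
        * (limitDenominator r α (riskSpectralLaw r α hΘ.law)
          - ∑ k ∈ Finset.range n, limitNumerator r α (riskSpectralLaw r α hΘ.law) (k + 1)))) := by
  have hR : ∀ t, Measurable fun ω => (r (X t ω) : ℝ) := fun t =>
    (hr.continuous.measurable.comp (hX t)).coe_nnreal_real
  rw [mul_sub, Finset.mul_sum]
  refine ((hΘ.tendsto_measureReal_clusterStarts hα hN hr hpos hX).sub
    (tendsto_finsetSum _ fun k _ => hΘ.tendsto_measureReal_isCluster hα hN hr hpos hX
      (Nat.le_add_left 1 k))).congr fun u => ?_
  rw [← Finset.sum_div, sum_measureReal_isCluster hR, ← sub_div, sub_sub_cancel]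

lemma IsSpectralTailProcess.exists_limitDenominator_sub_sum_le (hX : IsStationary P X) :
    ∃ c : ℝ, ∀ n : ℕ, limitDenominator r α (riskSpectralLaw r α hΘ.law)
      - ∑ k ∈ Finset.range n, limitNumerator r α (riskSpectralLaw r α hΘ.law) (k + 1)
        ≤ c / (n + 1) := by
  obtain ⟨C, hC, hrC⟩ := hr.exists_le_mul_supNorm
  have hR : IsStationary P fun t ω => (r (X t ω) : ℝ) :=
    hX.comp hr.continuous.measurable.coe_nnreal_real
  set κ := ∫ θ, (r (θ 0) : ℝ) ^ α ∂(hΘ.law : Measure (ℤ → CPlus K))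
  refine ⟨(C : ℝ) ^ α / κ, fun n => ?_⟩
  have hbound : ∀ u : ℝ, (n + 1) * P.real {ω | LongClusterStarts (fun t => (r (X t ω) : ℝ)) u 0 n}
      ≤ P.real {ω | u < C * supNorm (X 0 ω)} := fun u =>
    (hR.mul_measureReal_longClusterStarts_le u n).trans <|
      measureReal_mono fun ω (hω : u < r (X 0 ω)) => hω.trans_le (hrC _)
  have hlim := le_of_tendsto_of_tendsto'
    ((hΘ.tendsto_measureReal_longClusterStarts hα hN hr hpos hX.measurable n).const_mul (n + 1 : ℝ))
    (hN.tendsto_const_mul (NNReal.coe_pos.2 hC)) fun u => by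
      rw [← mul_div_assoc]
      exact div_le_div_of_nonneg_right (hbound u) (hN.pos u).le
  rw [le_div_iff₀ (by positivity), le_div_iff₀ hpos]
  linarith

lemma IsSpectralTailProcess.sum_limitNumerator_le (hX : ∀ t, Measurable (X t)) (n : ℕ) :
    ∑ k ∈ Finset.range n, limitNumerator r α (riskSpectralLaw r α hΘ.law) (k + 1)
      ≤ limitDenominator r α (riskSpectralLaw r α hΘ.law) := by
  have hlim := hΘ.tendsto_measureReal_longClusterStarts hα hN hr hpos hX n
  exact sub_nonneg.1 <| nonneg_of_mul_nonneg_right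
    (ge_of_tendsto' hlim fun u => div_nonneg measureReal_nonneg (hN.pos u).le) hpos

theorem IsSpectralTailProcess.hasSum_limitNumerator (hX : IsStationary P X) :
    HasSum (fun n : ℕ => limitNumerator r α (riskSpectralLaw r α hΘ.law) (n + 1))
      (limitDenominator r α (riskSpectralLaw r α hΘ.law)) := by
  obtain ⟨c, hc⟩ := hΘ.exists_limitDenominator_sub_sum_le hα hN hr hpos hX
  have hnonneg : ∀ n, 0 ≤ limitNumerator r α (riskSpectralLaw r α hΘ.law) (n + 1) := fun n =>
    integral_nonneg fun θ => le_max_right _ _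
  rw [hasSum_iff_tendsto_nat_of_nonneg hnonneg]
  have hdiff := squeeze_zero
    (fun n => sub_nonneg.2 (hΘ.sum_limitNumerator_le hα hN hr hpos hX.measurable n)) hc
    (tendsto_const_div_atTop_nhds_zero_nat c |>.comp (tendsto_add_atTop_nat 1) |>.congr fun n => by
      rw [Function.comp_apply, Nat.cast_add_one])
  simpa only [sub_sub_cancel, sub_zero] using
    hdiff.const_sub (limitDenominator r α (riskSpectralLaw r α hΘ.law))

theorem IsSpectralTailProcess.tendsto_clusterSizeProb (hX : ∀ t, Measurable (X t))
    (hden : 0 < limitDenominator r α (riskSpectralLaw r α hΘ.law)) {ℓ : ℕ} (hℓ : 1 ≤ ℓ) :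
    Tendsto (fun u : ℝ => clusterSizeProb P (fun t ω => (r (X t ω) : ℝ)) u ℓ) atTop
      (𝓝 (limitNumerator r α (riskSpectralLaw r α hΘ.law) ℓ
        / limitDenominator r α (riskSpectralLaw r α hΘ.law))) := by
  have hlim := (hΘ.tendsto_measureReal_isCluster hα hN hr hpos hX hℓ).div
    (hΘ.tendsto_measureReal_clusterStarts hα hN hr hpos hX) (mul_pos hpos hden).ne'
  rw [mul_div_mul_left _ _ hpos.ne'] at hlim
  exact hlim.congr fun u => div_div_div_cancel_right₀ (hN.pos u).ne' _ _

lemma IsSpectralTailProcess.eventually_measureReal_clusterStarts_pos (hX : ∀ t, Measurable (X t))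
    (hden : 0 < limitDenominator r α (riskSpectralLaw r α hΘ.law)) :
    ∀ᶠ u : ℝ in atTop, 0 < P.real {ω | ClusterStarts (fun t => (r (X t ω) : ℝ)) u 0} :=
  ((hΘ.tendsto_measureReal_clusterStarts hα hN hr hpos hX).eventually_const_lt
    (mul_pos hpos hden)).mono fun u hu => (div_pos_iff_of_pos_right (hN.pos u)).1 hu

end ClusterSizeLimit

end ClusterExtremes

end

open ClusterExtremes in
theorem mainTheorem5_general {K : Type*} [TopologicalSpace K] [CompactSpace K]
    [MeasurableSpace (CPlus K)] [BorelSpace (CPlus K)] [SecondCountableTopology (CPlus K)]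
    {Ω Ω' : Type*} [MeasurableSpace Ω] [MeasurableSpace Ω']
    (P : Measure Ω) [IsFiniteMeasure P] (P' : Measure Ω') [IsProbabilityMeasure P']
    (α : ℝ) (hα : 0 < α)
    (X : ℤ → Ω → CPlus K) (hX : IsStationary P X)
    (hN : HasRegularlyVaryingTail P (fun ω => supNorm (X 0 ω)) α)
    (Θ : ℤ → Ω' → CPlus K) (hΘ : IsSpectralTailProcess P X P' Θ)
    (r : CPlus K → ℝ≥0) (hr : IsRiskFunctional r)
    (hr_pos : 0 < ∫ ω, (r (Θ 0 ω) : ℝ) ^ α ∂P')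
    (Q : Measure (ℤ → CPlus K)) (hQ : Q = riskSpectralLaw r α (P'.map (fun ω t => Θ t ω)))
    (hden : 0 < limitDenominator r α Q) :
    (∀ᶠ u : ℝ in atTop, 0 < P.real {ω | ClusterStarts (fun t => (r (X t ω) : ℝ)) u 0}) ∧
    (∀ ℓ : ℕ, 1 ≤ ℓ →
      Tendsto (fun u : ℝ => clusterSizeProb P (fun t ω => (r (X t ω) : ℝ)) u ℓ) atTop
        (𝓝 (limitNumerator r α Q ℓ / limitDenominator r α Q)) ∧
      clusterSizeProb ((paretoMeasure 1 α).prod Q) (fun t p => p.1 * (r (p.2 t) : ℝ)) 1 ℓ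
        = limitNumerator r α Q ℓ / limitDenominator r α Q) ∧
    HasSum (fun n : ℕ => limitNumerator r α Q (n + 1) / limitDenominator r α Q) 1 ∧
    (∀ (wstar : EReal) (φ : ℝ → ℝ), IsMarginalTransform φ wstar →
      ∀ W : ℤ → Ω → C(K, ℝ),
      (∀ᵐ ω ∂P, ∀ t s, W t ω s ∈ below wstar ∧ (X t ω s : ℝ) = φ (W t ω s)) →
      ∀ rho : C(K, ℝ) → ℝ, CommutesWith r rho φ wstar →
        Tendsto (fun u : ℝ => (transformInv φ wstar u : EReal)) atTop (𝓝 wstar) ∧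
        ∀ ℓ : ℕ, 1 ≤ ℓ →
          (∀ u : ℝ, 0 < u →
            clusterSizeProb P (fun t ω => rho (W t ω)) (transformInv φ wstar u) ℓ
              = clusterSizeProb P (fun t ω => (r (X t ω) : ℝ)) u ℓ) ∧
          Tendsto (fun u : ℝ =>
              clusterSizeProb P (fun t ω => rho (W t ω)) (transformInv φ wstar u) ℓ) atTop
            (𝓝 (limitNumerator r α Q ℓ / limitDenominator r α Q))) := by
  obtain rfl : Q = riskSpectralLaw r α hΘ.law := hQ
  rw [← hΘ.integral_rpow_law hr] at hr_pos
  have := isProbabilityMeasure_riskSpectralLaw hr hr_pos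
  have hlim := fun ℓ (hℓ : 1 ≤ ℓ) =>
    hΘ.tendsto_clusterSizeProb hα hN hr hr_pos hX.measurable hden hℓ
  have hsum := hΘ.hasSum_limitNumerator hα hN hr hr_pos hX
  refine ⟨hΘ.eventually_measureReal_clusterStarts_pos hα hN hr hr_pos hX.measurable hden,
    fun ℓ hℓ => ⟨hlim ℓ hℓ, clusterSizeProb_paretoMeasure_prod hα hr
      (ae_riskSpectralLaw_eq_one hr hα.ne') hℓ⟩,
    div_self hden.ne' ▸ hsum.div_const _,
    fun wstar φ hφ W hWX rho hrho => ⟨hφ.tendsto_transformInv, fun ℓ hℓ =>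
      ⟨fun u hu => clusterSizeProb_transformInv hφ hWX hrho hu ℓ, (hlim ℓ hℓ).congr' ?_⟩⟩⟩
  filter_upwards [eventually_gt_atTop 0] with u hu
  exact (clusterSizeProb_transformInv hφ hWX hrho hu ℓ).symm

open ClusterExtremes in
theorem mainTheorem5 {d : ℕ} (S : Set (EuclideanSpace ℝ (Fin d))) [CompactSpace S]
    [MeasurableSpace (CPlus S)] [BorelSpace (CPlus S)]
    [MeasurableSpace C(S, ℝ)] [BorelSpace C(S, ℝ)]
    {Ω Ω' : Type*} [MeasurableSpace Ω] [MeasurableSpace Ω']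
    (P : Measure Ω) [IsProbabilityMeasure P] (P' : Measure Ω') [IsProbabilityMeasure P']
    (α : ℝ) (hα : 0 < α)
    (X : ℤ → Ω → CPlus S) (hX : IsRegularlyVarying P X α)
    (Θ : ℤ → Ω' → CPlus S) (hΘ : IsSpectralTailProcess P X P' Θ)
    (r : CPlus S → ℝ≥0) (hr : IsRiskFunctional r)
    (hr_pos : 0 < ∫ ω, (r (Θ 0 ω) : ℝ) ^ α ∂P')
    (Q : Measure (ℤ → CPlus S)) (hQ : Q = riskSpectralLaw r α (P'.map (fun ω t => Θ t ω)))
    (hden : 0 < limitDenominator r α Q) :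
    -- the cluster size distribution is well defined for all large thresholds
    (∀ᶠ u : ℝ in atTop, 0 < P.real {ω | ClusterStarts (fun t => (r (X t ω) : ℝ)) u 0}) ∧
    -- the limit of the cluster size probabilities, and its expression through an independent
    -- Pareto variable
    (∀ ℓ : ℕ, 1 ≤ ℓ →
      Tendsto (fun u : ℝ => clusterSizeProb P (fun t ω => (r (X t ω) : ℝ)) u ℓ) atTop
        (𝓝 (limitNumerator r α Q ℓ / limitDenominator r α Q)) ∧
      clusterSizeProb ((paretoMeasure 1 α).prod Q) (fun t p => p.1 * (r (p.2 t) : ℝ)) 1 ℓ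
        = limitNumerator r α Q ℓ / limitDenominator r α Q) ∧
    -- the limits form a probability distribution on the positive integers
    HasSum (fun n : ℕ => limitNumerator r α Q (n + 1) / limitDenominator r α Q) 1 ∧
    -- monotone transforms
    (∀ (wstar : EReal) (φ : ℝ → ℝ), IsMarginalTransform φ wstar →
      ∀ W : ℤ → Ω → C(S, ℝ), IsStationary P W →
      (∀ᵐ ω ∂P, ∀ t s, W t ω s ∈ below wstar ∧ (X t ω s : ℝ) = φ (W t ω s)) →
      ∀ rho : C(S, ℝ) → ℝ, CommutesWith r rho φ wstar →
        Tendsto (fun u : ℝ => (transformInv φ wstar u : EReal)) atTop (𝓝 wstar) ∧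
        ∀ ℓ : ℕ, 1 ≤ ℓ →
          (∀ u : ℝ, 0 < u →
            clusterSizeProb P (fun t ω => rho (W t ω)) (transformInv φ wstar u) ℓ
              = clusterSizeProb P (fun t ω => (r (X t ω) : ℝ)) u ℓ) ∧
          Tendsto (fun u : ℝ =>
              clusterSizeProb P (fun t ω => rho (W t ω)) (transformInv φ wstar u) ℓ) atTop
            (𝓝 (limitNumerator r α Q ℓ / limitDenominator r α Q))) := by
  obtain ⟨hpos, hlim, hsum, htransform⟩ := mainTheorem5_general P P' α hα X hX.stationary
    hX.hasRegularlyVaryingTail Θ hΘ r hr hr_pos Q hQ hden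
  exact ⟨hpos, hlim, hsum, fun wstar φ hφ W _ => htransform wstar φ hφ W⟩
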